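/- Let $\Gamma$ be a countably infinite group and let $(X,\mu)$ be a Lebesgue probability space, i.e. a standard Borel space with a non-atomic probability measure. Let $\mathrm{Aut}(X,\mu)$ be the group of invertible measure-preserving transformations of $(X,\mu)$, two of them being identified when they agree almost everywhere, with the weak topology ($T_i\to T$ iff $\mu(T_iA\,\triangle\,TA)\to 0$ for every measurable $A\subset X$), and let $A(\Gamma,X,\mu)$ be the space of all homomorphisms $\Gamma\to\mathrm{Aut}(X,\mu)$ with the topology of pointwise convergence. For a countable measurable partition $\mathcal P$ of $X$ let $H_\mu(\mathcal P)=-\sum_{P\in\mathcal P}\mu(P)\log\mu(P)$. The naive entropy of an action $\mathbf a\in A(\Gamma,X,\mu)$ is $$\sup_{\mathcal P}\ \inf_{W}\ \frac{1}{|W|}\,H_\mu\Big(\bigvee_{t\in W}t^{-1}\mathcal P\Big),$$ where $\mathcal P$ ranges over the measurable partitions with $H_\mu(\mathcal P)<\infty$ and $W$ over the non-empty finite subsets of $\Gamma$. We say that $\Gamma$ has property MD if at least one of the following holds: (a) the measure-conjugacy class of the action $p_\Gamma\times\iota$ is dense in $A(\Gamma,[0,1],\mathrm{Leb})$, where $p_\Gamma$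 is the action of $\Gamma$ by left translations on its profinite completion with Haar probability measure, and $\iota$ is the trivial action of $\Gamma$ on the unit interval with Lebesgue measure; (b) the measures with finite support are dense, in the weak* topology, in the space of $\Gamma$-invariant Borel probability measures on $\mathcal C^\Gamma$, where $\mathcal C$ is the middle-thirds Cantor set and $(gx)(f)=x(g^{-1}f)$ for $x\in\mathcal C^\Gamma$ and $g,f\in\Gamma$. (The two conditions are equivalent when $\Gamma$ is finitely generated.) Suppose that either $\Gamma$ has property MD, or $\Gamma\cong G\times H$ for some groups $G$ and $H$ where $H$ is infinite, amenable and residually finite. Then the set of actions $\mathbf a\in A(\Gamma,X,\mu)$ with zero naive entropy is residual: it contains a dense $G_\delta$ subset of $A(\Gamma,X,\mu)$. -/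

import Mathlib

open MeasureTheory Set Topology
open scoped ENNReal symmDiff

universe u v w

noncomputable section

/-! ### The group `Aut(X, μ)` and the space of actions `A(Γ, X, μ)` -/

section Aut

variable {X : Type v} [MeasurableSpace X]

/-- The bijections of `X` that are measure-preserving in both directions, as a group of
permutations (without any identification). -/
def mpSubgroup (μ : Measure X) : Subgroup (Equiv.Perm X) where
  carrier := {T | MeasurePreserving T μ μ ∧ MeasurePreserving T.symm μ μ}
  mul_mem' := fun {_ _} hS hT => ⟨hS.1.comp hT.1, hT.2.comp hS.2⟩
  one_mem' := ⟨MeasurePreserving.id μ, MeasurePreserving.id μ⟩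
  inv_mem' := fun {_} hT => ⟨hT.2, hT.1⟩

/-- The type of invertible measure-preserving transformations of `(X, μ)`. -/
def MPTrans (μ : Measure X) : Type v := mpSubgroup μ

instance (μ : Measure X) : Group (MPTrans μ) := inferInstanceAs (Group (mpSubgroup μ))

/-- The underlying map of a measure-preserving transformation. -/
def MPTrans.map {μ : Measure X} (T : MPTrans μ) : X → X := fun x => (T.1 : Equiv.Perm X) x

/-- The transformations that agree almost everywhere with the identity. -/
def aeTrivial (μ : Measure X) : Subgroup (MPTrans μ) where
  carrier := {T | T.map =ᵐ[μ] id}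
  mul_mem' := fun {S T} hS hT => by
    have h : (S.map ∘ T.map) =ᵐ[μ] (id ∘ T.map) :=
      T.2.1.quasiMeasurePreserving.ae_eq_comp hS
    exact h.trans hT
  one_mem' := by
    show (1 : MPTrans μ).map =ᵐ[μ] id
    exact Filter.Eventually.of_forall fun _ => rfl
  inv_mem' := fun {T} hT => by
    have h : (T.map ∘ (T⁻¹).map) =ᵐ[μ] (id ∘ (T⁻¹).map) :=
      T.2.2.quasiMeasurePreserving.ae_eq_comp hT
    have h2 : T.map ∘ (T⁻¹).map = id := by
      funext x
      exact Equiv.apply_symm_apply (T.1 : Equiv.Perm X) x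
    rw [h2] at h
    exact h.symm

instance (μ : Measure X) : (aeTrivial μ).Normal where
  conj_mem := fun T hT S => by
    have h1 : (T.map ∘ (S⁻¹).map) =ᵐ[μ] (id ∘ (S⁻¹).map) :=
      S.2.2.quasiMeasurePreserving.ae_eq_comp hT
    have h2 : (S.map ∘ (T.map ∘ (S⁻¹).map)) =ᵐ[μ] (S.map ∘ (id ∘ (S⁻¹).map)) :=
      h1.fun_comp S.map
    have h3 : S.map ∘ (id ∘ (S⁻¹).map) = id := by
      funext x
      exact Equiv.apply_symm_apply (S.1 : Equiv.Perm X) x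
    rw [h3] at h2
    exact h2

/-- The image `T A` of a measurable set `A`, as a point of the space of measurable sets with the
pseudo-metric `μ (A ∆ B)`. -/
def MPTrans.image {μ : Measure X} (T : MPTrans μ) (A : MeasuredSets μ) : MeasuredSets μ :=
  ⟨T.map '' A, by
    have h : T.map '' A = (T.1 : Equiv.Perm X).symm ⁻¹' A :=
      Equiv.image_eq_preimage_symm (T.1 : Equiv.Perm X) A
    rw [h]
    exact T.2.2.measurable A.2⟩

/-- The weak topology: `Tᵢ → T` iff `μ (Tᵢ A ∆ T A) → 0` for every measurable set `A`. -/
instance (μ : Measure X) : TopologicalSpace (MPTrans μ) :=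
  TopologicalSpace.induced MPTrans.image (Pi.topologicalSpace (Y := fun _ => MeasuredSets μ))

/-- `Aut(X, μ)`: invertible measure-preserving transformations, two of them being identified when
they agree almost everywhere. It carries the quotient of the weak topology. -/
abbrev MPAut (μ : Measure X) : Type v := MPTrans μ ⧸ aeTrivial μ

/-- A pointwise representative of an element of `Aut(X, μ)`; it is unique up to null sets, and
everything below is insensitive to the choice. -/
def MPAut.rep {μ : Measure X} (T : MPAut μ) : X → X := (Quotient.out T : MPTrans μ).map

/-- `A(Γ, X, μ)`: the space of homomorphisms `Γ → Aut(X, μ)`. -/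
def ActionSpace (Γ : Type u) [Group Γ] (μ : Measure X) : Type (max u v) := Γ →* MPAut μ

/-- The topology of pointwise convergence on `A(Γ, X, μ)`. -/
instance (Γ : Type u) [Group Γ] (μ : Measure X) : TopologicalSpace (ActionSpace Γ μ) :=
  TopologicalSpace.induced (fun (a : Γ →* MPAut μ) (g : Γ) => a g) Pi.topologicalSpace

/-- The (almost everywhere defined) map by which `g` acts on `X` under the action `a`. -/
def ActionSpace.act {Γ : Type u} [Group Γ] {μ : Measure X} (a : ActionSpace Γ μ) (g : Γ) :
    X → X :=
  MPAut.rep ((show Γ →* MPAut μ from a) g)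

end Aut

/-! ### Naive entropy

A countable measurable partition is given by a measurable labelling `P : X → ℕ`; its parts are
the (non-empty) fibres of `P`. A partition with finite Shannon entropy is countable up to a null
set. -/

section Entropy

variable {X : Type v} [MeasurableSpace X]

/-- Shannon entropy `-∑ μ(P) log μ(P)` of the partition of `X` into the fibres of `P`. -/
def shannonEntropy {ι : Type w} (μ : Measure X) (P : X → ι) : ℝ≥0∞ :=
  ∑' i, ENNReal.ofReal (Real.negMulLog (μ.real (P ⁻¹' {i})))

/-- The labelling of the partition `P^W = ⋁_{t ∈ W} t⁻¹ P`: two points are in the same part iff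
`t x` and `t y` are in the same part of `P` for each `t ∈ W`. -/
def joinLabel {Γ : Type u} [Group Γ] {μ : Measure X} (a : ActionSpace Γ μ) (W : Finset Γ)
    (P : X → ℕ) : X → (W → ℕ) :=
  fun x t => P (a.act t x)

/-- Naive entropy of a partition: infimum of `H(P^W) / |W|` over finite non-empty `W ⊆ Γ`. -/
def naiveEntropyPartition {Γ : Type u} [Group Γ] {μ : Measure X} (a : ActionSpace Γ μ)
    (P : X → ℕ) : ℝ≥0∞ :=
  ⨅ (W : Finset Γ) (_ : W.Nonempty), shannonEntropy μ (joinLabel a W P) / (W.card : ℝ≥0∞)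

/-- Naive entropy of an action: supremum of the naive entropies of the measurable partitions with
finite Shannon entropy. -/
def naiveEntropy {Γ : Type u} [Group Γ] {μ : Measure X} (a : ActionSpace Γ μ) : ℝ≥0∞ :=
  ⨆ (P : X → ℕ) (_ : Measurable P) (_ : shannonEntropy μ P ≠ ⊤), naiveEntropyPartition a P

end Entropy

/-! ### Property MD -/

section MD

/-- The action `a` on `(X, μ)` is measurably conjugate to the family of maps `T g` on `(Y, ν)`:
there is an isomorphism `(X, μ) → (Y, ν)` modulo null sets that is almost everywhere
equivariant. -/
def IsMeasureConjugate {Γ : Type u} [Group Γ] {X : Type v} [MeasurableSpace X] {μ : Measure X}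
    (a : ActionSpace Γ μ) {Y : Type w} [MeasurableSpace Y] (ν : Measure Y) (T : Γ → Y → Y) :
    Prop :=
  ∃ (φ : X → Y) (ψ : Y → X), MeasurePreserving φ μ ν ∧ MeasurePreserving ψ ν μ ∧
    ψ ∘ φ =ᵐ[μ] id ∧ φ ∘ ψ =ᵐ[ν] id ∧ ∀ g : Γ, φ ∘ a.act g =ᵐ[μ] T g ∘ φ

/-- The profinite completion of `Γ`. -/
abbrev ProfiniteCompl (Γ : Type u) [Group Γ] : ProfiniteGrp.{u} :=
  ProfiniteGrp.ProfiniteCompletion.completion (GrpCat.of Γ)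

instance (Γ : Type u) [Group Γ] : MeasurableSpace (ProfiniteCompl Γ) := borel _

instance (Γ : Type u) [Group Γ] : BorelSpace (ProfiniteCompl Γ) := ⟨rfl⟩

/-- Haar probability measure on the profinite completion. -/
def profiniteHaar (Γ : Type u) [Group Γ] : Measure (ProfiniteCompl Γ) :=
  Measure.haarMeasure ⊤

/-- The action `p_Γ × ι` of `Γ` on the product of its profinite completion with the unit
interval: left translation on the first factor, trivial on the second. -/
def profiniteTimesTrivial (Γ : Type u) [Group Γ] (g : Γ) :
    ProfiniteCompl Γ × unitInterval → ProfiniteCompl Γ × unitInterval :=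
  fun p => (ProfiniteGrp.ProfiniteCompletion.etaFn (GrpCat.of Γ) g * p.1, p.2)

/-- The measure conjugacy class of `p_Γ × ι` is dense in `A(Γ, X, μ)`, where `(X, μ)` is the
unit interval with Lebesgue measure. -/
def ProfiniteClassDense (Γ : Type u) [Group Γ] : Prop :=
  Dense {a : ActionSpace Γ (volume : Measure unitInterval) |
    IsMeasureConjugate a ((profiniteHaar Γ).prod (volume : Measure unitInterval))
      (profiniteTimesTrivial Γ)}

/-- The shift action of `Γ` on `𝒞^Γ`, where `𝒞` is the middle-thirds Cantor set. -/
def cantorShift {Γ : Type u} [Group Γ] (g : Γ) (x : Γ → cantorSet) : Γ → cantorSet :=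
  fun f => x (g⁻¹ * f)

/-- `Prob_Γ(𝒞^Γ)`: shift-invariant Borel probability measures, with the weak* topology. -/
abbrev InvProb (Γ : Type u) [Group Γ] [Countable Γ] : Type u :=
  {ν : ProbabilityMeasure (Γ → cantorSet) //
    ∀ g : Γ, (ν : Measure (Γ → cantorSet)).map (cantorShift g) = ν}

/-- The invariant measures with finite support are dense in `Prob_Γ(𝒞^Γ)`. -/
def FiniteSupportDense (Γ : Type u) [Group Γ] [Countable Γ] : Prop :=
  Dense {ν : InvProb Γ | ∃ S : Set (Γ → cantorSet), S.Finite ∧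
    (ν.1 : Measure (Γ → cantorSet)) Sᶜ = 0}

/-- Property MD, in either of its two usual forms. They agree when the profinite completion of
`Γ` is metrizable (e.g. `Γ` finitely generated); otherwise `p_Γ × ι` does not live on a Lebesgue
space, only the second form can hold, and it is the intended one (e.g. for free groups of
infinite rank). -/
def HasMD (Γ : Type u) [Group Γ] [Countable Γ] : Prop :=
  ProfiniteClassDense Γ ∨ FiniteSupportDense Γ

end MD

/-! ### Amenable groups -/

/-- Amenability of a discrete group, as the Følner condition. -/
def IsAmenableGroup (H : Type u) [Group H] : Prop :=
  ∀ (K : Finset H) (ε : ℝ), 0 < ε → ∃ F : Finset H, F.Nonempty ∧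
    ∀ k ∈ K, ((((fun x => k * x) '' (F : Set H)) ∆ (F : Set H)).ncard : ℝ) ≤ ε * (F.card : ℝ)

end

/-!
Call an action *rigid* if infinitely many elements of the group act by transformations arbitrarily
near the identity in the weak topology. The residual set of the theorem is the set of all rigid
actions.

*It is a `G_δ`* (`ActionSpace.isGδ_setOf_isRigid`), because the measure algebra is separable, so
that the identity of `Aut(X, μ)` has a countable basis of neighbourhoods.

*Rigid actions have zero naive entropy* (`ActionSpace.IsRigid.naiveEntropy_eq_zero`). If `W`
consists of many elements that hardly move the partition `P`, then the labels `P (t x)`, `t ∈ W`,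
are almost determined by `P x`. By Gibbs' inequality the entropy of the join is at most the mean
length of any code for these labels, and a code that spends `H(P)` on `P x` and next to nothing on
each of the other labels is at hand (`shannonEntropy_pi_le`).

*Rigid actions are dense.* By `ActionSpace.mem_closure_isRigid_of_forall_exists_infinite_ker` it
suffices to approximate the joint distribution of finitely many translates of a finite label `P`
along the given action by such distributions along actions `b` with infinite kernel, on arbitrary
standard Borel probability spaces. The product of `b` with the trivial action on the unit interval
can then be conjugated close to the given action, since partitions of Lebesgue spaces with almost
the same distribution can almost be mapped to each other by an isomorphism
(`exists_measurableEquiv_measure_ne_le`).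

* If finitely supported measures are dense in the invariant measures on `𝒞^Γ`, the label `P` gives
  an invariant measure on `𝒞^Γ`. The nearby finitely supported measures are as required, because
  `Γ` acts on their finitely many atoms by permutations.
* If the class of `p_Γ × ι` is dense, no approximation is needed: these actions are rigid, because
  translations of a compact group are continuous in measure, and an infinite group returns
  infinitely often to every neighbourhood of the identity of a compact group.
* If `Γ = G × H` with `H` amenable and residually finite, let `G` act on the first factor of
  `X × C` as it acts on `X`, and let `H` act on the second factor `C`, a finite `H`-set. For a map
  `θ : C → H` that is equivariant at most points, the label `P (θ(c) x)` at `(x, c)` has almost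
  the required distribution. Such a `θ` comes from a Følner set and a random order on `C`
  (`exists_almost_equivariant_of_folner`); no tiling of `H` is involved.
-/

/-! ### The group `Aut(X, μ)` and its topology -/

lemma nhds_eq_comap_edist {α : Type*} [PseudoEMetricSpace α] (x : α) :
    𝓝 x = Filter.comap (fun y => edist y x) (𝓝 0) :=
  Metric.nhds_basis_eball.eq_of_same_basis (ENNReal.nhds_zero_basis.comap _)

namespace MPTrans

variable {X : Type*} [MeasurableSpace X] {μ : Measure X}

lemma measurePreserving_map (T : MPTrans μ) : MeasurePreserving T.map μ μ := T.2.1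

lemma map_mul (S T : MPTrans μ) : (S * T).map = S.map ∘ T.map := rfl

lemma map_one : (1 : MPTrans μ).map = id := rfl

lemma map_inv_comp (T : MPTrans μ) : (T⁻¹).map ∘ T.map = id := by
  rw [← map_mul, inv_mul_cancel, map_one]

/-- The image is a preimage under the inverse, and is easier to handle in this form. -/
lemma coe_image (T : MPTrans μ) (A : MeasuredSets μ) :
    (T.image A : Set X) = (T⁻¹).map ⁻¹' (A : Set X) :=
  Equiv.image_eq_preimage_symm (T.1 : Equiv.Perm X) A

lemma isInducing_image : IsInducing (MPTrans.image (μ := μ)) := ⟨rfl⟩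

lemma continuous_image (A : MeasuredSets μ) : Continuous fun T : MPTrans μ => T.image A :=
  (continuous_apply A).comp isInducing_image.continuous

end MPTrans

namespace MPAut

variable {X : Type*} [MeasurableSpace X] {μ : Measure X}

lemma mk_eq_mk_iff {S T : MPTrans μ} : (S : MPAut μ) = T ↔ S.map =ᵐ[μ] T.map := by
  rw [QuotientGroup.eq]
  change (S⁻¹ * T).map =ᵐ[μ] id ↔ _
  rw [MPTrans.map_mul]
  constructor
  · intro h
    have h2 := h.fun_comp S.map
    have h3 : S.map ∘ ((S⁻¹).map ∘ T.map) = T.map := by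
      rw [← Function.comp_assoc, ← MPTrans.map_mul, mul_inv_cancel, MPTrans.map_one,
        Function.id_comp]
    rw [h3] at h2
    exact h2.symm
  · intro h
    have h2 := h.fun_comp (S⁻¹).map
    rw [MPTrans.map_inv_comp] at h2
    exact h2.symm

lemma rep_mk (T : MPTrans μ) : MPAut.rep (T : MPAut μ) =ᵐ[μ] T.map :=
  mk_eq_mk_iff.1 (Quotient.out_eq (T : MPAut μ))

lemma measurePreserving_rep (T : MPAut μ) : MeasurePreserving T.rep μ μ :=
  MPTrans.measurePreserving_map _

lemma mk_out (T : MPAut μ) : ((Quotient.out T : MPTrans μ) : MPAut μ) = T := Quotient.out_eq T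

lemma rep_mul (S T : MPAut μ) : (S * T).rep =ᵐ[μ] S.rep ∘ T.rep := by
  have h := rep_mk ((Quotient.out S : MPTrans μ) * (Quotient.out T : MPTrans μ))
  rw [QuotientGroup.mk_mul, mk_out, mk_out] at h
  exact h

lemma rep_one : (1 : MPAut μ).rep =ᵐ[μ] id := rep_mk (1 : MPTrans μ)

lemma ext_rep {S T : MPAut μ} (h : S.rep =ᵐ[μ] T.rep) : S = T := by
  rw [← mk_out S, ← mk_out T]
  exact mk_eq_mk_iff.2 h

/-- The image of a measurable set under an element of `Aut(X, μ)`, well defined up to a null set. -/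
noncomputable def image (T : MPAut μ) (A : MeasuredSets μ) : MeasuredSets μ :=
  (Quotient.out T : MPTrans μ).image A

lemma inseparable_image_of_ae_eq {S T : MPTrans μ} (h : S.map =ᵐ[μ] T.map) (A : MeasuredSets μ) :
    Inseparable (S.image A) (T.image A) := by
  rw [EMetric.inseparable_iff, MeasuredSets.edist_def, measure_symmDiff_eq_zero_iff,
    MPTrans.coe_image, MPTrans.coe_image]
  have h2 : (S⁻¹).map =ᵐ[μ] (T⁻¹).map := by
    have := (mk_eq_mk_iff.2 h)
    rw [← mk_eq_mk_iff, QuotientGroup.mk_inv, QuotientGroup.mk_inv, this]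
  exact h2.preimage A

lemma continuous_mk : Continuous (fun T : MPTrans μ => (T : MPAut μ)) := continuous_quotient_mk'

/-- The weak topology does not see null sets, so open sets of transformations are saturated and
the quotient topology is again the topology of convergence on measurable sets. -/
lemma isInducing_image : IsInducing (MPAut.image (μ := μ)) := by
  have hcont : Continuous (MPAut.image (μ := μ)) := by
    refine continuous_pi fun A => (QuotientGroup.isQuotientMap_mk _).continuous_iff.2 ?_
    have h : (SeparationQuotient.mk ∘ ((fun T : MPAut μ => T.image A) ∘
        fun T : MPTrans μ => (T : MPAut μ))) = SeparationQuotient.mk ∘ fun T => T.image A := by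
      funext T
      exact SeparationQuotient.mk_eq_mk.2 (inseparable_image_of_ae_eq (rep_mk T) A)
    rw [SeparationQuotient.isInducing_mk.continuous_iff]
    exact h.symm ▸ SeparationQuotient.continuous_mk.comp (MPTrans.continuous_image A)
  refine ⟨le_antisymm hcont.le_induced fun U hU => ?_⟩
  have hU' : IsOpen ((fun T : MPTrans μ => (T : MPAut μ)) ⁻¹' U) := hU.preimage continuous_mk
  obtain ⟨V, hV, hVU⟩ := MPTrans.isInducing_image.isOpen_iff.1 hU'
  refine ⟨V, hV, ?_⟩
  ext T
  change (Quotient.out T : MPTrans μ) ∈ MPTrans.image ⁻¹' V ↔ _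
  rw [hVU, mem_preimage, mk_out]

lemma coe_image_ae_eq (T : MPAut μ) (A : MeasuredSets μ) :
    (T.image A : Set X) =ᵐ[μ] (T⁻¹).rep ⁻¹' (A : Set X) := by
  have h : (T.image A : Set X) = ((Quotient.out T : MPTrans μ)⁻¹).map ⁻¹' (A : Set X) :=
    MPTrans.coe_image _ _
  rw [h]
  refine Filter.EventuallyEq.preimage ?_ _
  refine (rep_mk _).symm.trans ?_
  rw [QuotientGroup.mk_inv, mk_out]

/-- The neighbourhoods of the identity in `Aut(X, μ)`, by means of the preimages of sets. -/
lemma nhds_one_eq : 𝓝 (1 : MPAut μ) = ⨅ A : MeasuredSets μ,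
    Filter.comap (fun T : MPAut μ => μ ((T.rep ⁻¹' (A : Set X)) ∆ A)) (𝓝 0) := by
  rw [isInducing_image.nhds_eq_comap, nhds_pi, Filter.pi, Filter.comap_iInf]
  refine iInf_congr fun A => ?_
  rw [nhds_eq_comap_edist, Filter.comap_comap, Filter.comap_comap]
  congr 1
  funext T
  simp only [Function.comp, MeasuredSets.edist_def]
  have h1 : ((1 : MPAut μ).image A : Set X) =ᵐ[μ] (A : Set X) := by
    refine (coe_image_ae_eq 1 A).trans ?_
    rw [inv_one]
    exact rep_one.preimage (A : Set X)
  have h2 : (T.rep ⁻¹' ((T⁻¹).rep ⁻¹' (A : Set X))) =ᵐ[μ] (A : Set X) := by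
    have h := (rep_mul T⁻¹ T).symm
    rw [inv_mul_cancel] at h
    exact (h.trans rep_one).preimage (A : Set X)
  have h3 : MeasurableSet (((T⁻¹).rep ⁻¹' (A : Set X)) ∆ (A : Set X)) :=
    ((measurePreserving_rep _).measurable A.2).symmDiff A.2
  change μ ((T.image A : Set X) ∆ ((1 : MPAut μ).image A : Set X)) = _
  rw [measure_congr ((coe_image_ae_eq T A).symmDiff h1),
    ← (measurePreserving_rep T).measure_preimage h3.nullMeasurableSet, preimage_symmDiff,
    measure_congr (h2.symmDiff (ae_eq_refl (T.rep ⁻¹' (A : Set X)))), symmDiff_comm]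

/-- It suffices to test convergence to the identity on the sets of a countable dense family. -/
instance [IsFiniteMeasure μ] [IsSeparable μ] : (𝓝 (1 : MPAut μ)).IsCountablyGenerated := by
  obtain ⟨𝒜, h𝒜c, h𝒜⟩ := exists_countable_measureDense (μ := μ)
  have : Countable 𝒜 := h𝒜c.to_subtype
  have key : 𝓝 (1 : MPAut μ) = ⨅ A : 𝒜,
      Filter.comap (fun T : MPAut μ => μ ((T.rep ⁻¹' (A : Set X)) ∆ A)) (𝓝 0) := by
    rw [nhds_one_eq]
    refine le_antisymm (le_iInf fun A => iInf_le_of_le ⟨A.1, h𝒜.measurable A A.2⟩ le_rfl)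
      (le_iInf fun A => ?_)
    rw [← Filter.tendsto_iff_comap, ENNReal.tendsto_nhds_zero]
    intro ε hε
    have hε3 : 0 < ε / 3 := ENNReal.div_pos hε.ne' (by norm_num)
    obtain ⟨δ, hδ0, hδ⟩ := ENNReal.lt_iff_exists_nnreal_btwn.1 hε3
    obtain ⟨B, hB, hAB⟩ := h𝒜.approx A A.2 (measure_ne_top μ _) δ (by exact_mod_cast hδ0)
    rw [ENNReal.ofReal_coe_nnreal] at hAB
    have h1 : Filter.Tendsto (fun T : MPAut μ => μ ((T.rep ⁻¹' B) ∆ B))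
        (⨅ A : 𝒜, Filter.comap (fun T : MPAut μ => μ ((T.rep ⁻¹' (A : Set X)) ∆ A)) (𝓝 0))
        (𝓝 0) := Filter.tendsto_iff_comap.2 (iInf_le _ (⟨B, hB⟩ : 𝒜))
    filter_upwards [(ENNReal.tendsto_nhds_zero.1 h1) _ hε3] with T hT
    have h2 : μ ((T.rep ⁻¹' (A : Set X)) ∆ (T.rep ⁻¹' B)) ≤ ε / 3 := by
      have hm : MeasurableSet ((A : Set X) ∆ B) := A.2.symmDiff (h𝒜.measurable B hB)
      rw [← preimage_symmDiff, (measurePreserving_rep T).measure_preimage hm.nullMeasurableSet]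
      exact (hAB.trans hδ).le
    have h3 : μ (B ∆ (A : Set X)) ≤ ε / 3 := by
      rw [symmDiff_comm]
      exact (hAB.trans hδ).le
    calc μ ((T.rep ⁻¹' (A : Set X)) ∆ A)
        ≤ μ ((T.rep ⁻¹' (A : Set X)) ∆ (T.rep ⁻¹' B)) + μ ((T.rep ⁻¹' B) ∆ B) + μ (B ∆ A) :=
          (measure_symmDiff_le _ B _).trans (by gcongr; exact measure_symmDiff_le _ _ _)
      _ ≤ ε / 3 + ε / 3 + ε / 3 := by gcongr
      _ = ε := ENNReal.add_thirds ε
  rw [key]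
  infer_instance

end MPAut

/-! ### Rigid actions -/

namespace ActionSpace

variable {Γ : Type*} [Group Γ] {X : Type*} [MeasurableSpace X] {μ : Measure X}

/-- The homomorphism `Γ → Aut(X, μ)` that an action is. -/
def hom (a : ActionSpace Γ μ) : Γ →* MPAut μ := a

lemma measurePreserving_act (a : ActionSpace Γ μ) (g : Γ) : MeasurePreserving (a.act g) μ μ :=
  MPAut.measurePreserving_rep _

lemma act_mul (a : ActionSpace Γ μ) (g h : Γ) :
    a.act (g * h) =ᵐ[μ] a.act g ∘ a.act h := by
  change (a.hom (g * h)).rep =ᵐ[μ] _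
  rw [_root_.map_mul]
  exact MPAut.rep_mul _ _

lemma continuous_apply (g : Γ) : Continuous fun a : ActionSpace Γ μ => a.hom g :=
  (_root_.continuous_apply g).comp (IsInducing.mk rfl :
    IsInducing fun (a : ActionSpace Γ μ) (g : Γ) => a.hom g).continuous

/-- An action is rigid if the identity is a limit of the transformations by which infinitely many
elements of the group act. -/
def IsRigid (a : ActionSpace Γ μ) : Prop :=
  ∀ U ∈ 𝓝 (1 : MPAut μ), {g : Γ | a.hom g ∈ U}.Infinite

lemma IsRigid.of_infinite_ker {a : ActionSpace Γ μ}
    (h : {g : Γ | a.hom g = 1}.Infinite) : a.IsRigid :=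
  fun _ hU => h.mono fun _ hg => by
    simp only [mem_ofPred_eq] at hg ⊢
    rw [hg]
    exact mem_of_mem_nhds hU

lemma isGδ_setOf_isRigid [IsFiniteMeasure μ] [IsSeparable μ] :
    IsGδ {a : ActionSpace Γ μ | a.IsRigid} := by
  obtain ⟨V, hV⟩ := (𝓝 (1 : MPAut μ)).exists_antitone_basis
  have key : {a : ActionSpace Γ μ | a.IsRigid} = ⋂ n : ℕ, ⋂ m : ℕ,
      {a : ActionSpace Γ μ | ∃ W : Finset Γ, m < W.card ∧
        ∀ g ∈ W, a.hom g ∈ interior (V n)} := by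
    ext a
    simp only [mem_ofPred_eq, mem_iInter]
    constructor
    · intro ha n m
      obtain ⟨W, hW, hWc⟩ := (ha _ (interior_mem_nhds.2 (hV.mem n))).exists_subset_card_eq (m + 1)
      exact ⟨W, by omega, fun g hg => hW hg⟩
    · intro ha U hU hfin
      obtain ⟨n, hn⟩ := hV.mem_iff.1 hU
      obtain ⟨W, hWc, hW⟩ := ha n hfin.toFinset.card
      refine hWc.not_ge (Finset.card_le_card fun g hg => ?_)
      simpa using hn (interior_subset (hW g hg))
  rw [key]
  refine .iInter fun n => .iInter_of_isOpen fun m => ?_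
  have h : {a : ActionSpace Γ μ | ∃ W : Finset Γ, m < W.card ∧
        ∀ g ∈ W, a.hom g ∈ interior (V n)} =
      ⋃ (W : Finset Γ) (_ : m < W.card), ⋂ g ∈ W,
        (fun a : ActionSpace Γ μ => a.hom g) ⁻¹' interior (V n) := by
    ext a
    simp
  rw [h]
  exact isOpen_biUnion fun W _ => isOpen_biInter_finset fun g _ =>
    isOpen_interior.preimage (continuous_apply g)

/-- A criterion for an action to be a limit of actions from a set, by means of preimages of
measurable sets. -/
lemma mem_closure_of_forall {S : Set (ActionSpace Γ μ)} {a : ActionSpace Γ μ}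
    (h : ∀ (K : Finset Γ) (𝒜 : Finset (MeasuredSets μ)) (ε : ℝ≥0∞), 0 < ε → ∃ b ∈ S,
      ∀ g ∈ K, ∀ A ∈ 𝒜, μ ((b.act g ⁻¹' (A : Set X)) ∆ (a.act g ⁻¹' (A : Set X))) < ε) :
    a ∈ closure S := by
  let Φ : ActionSpace Γ μ → Γ × MeasuredSets μ → MeasuredSets μ :=
    fun b p => (b.hom p.1).image p.2
  have hΦ : IsInducing Φ := by
    have h1 : IsInducing fun (a : ActionSpace Γ μ) (g : Γ) => a.hom g := ⟨rfl⟩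
    have h2 := (IsInducing.piMap fun _ : Γ => MPAut.isInducing_image (μ := μ)).comp h1
    exact (Homeomorph.piCurry (X := Γ) (Y := MeasuredSets μ)
      (Z := MeasuredSets μ)).symm.isInducing.comp h2
  rw [hΦ.closure_eq_preimage_closure_image, mem_preimage, mem_closure_iff_nhds]
  intro t ht
  rw [nhds_pi, Filter.mem_pi] at ht
  obtain ⟨I, hI, t', ht', hsub⟩ := ht
  classical
  have hε : ∃ ε : ℝ≥0∞, 0 < ε ∧ ∀ i ∈ I, Metric.eball (Φ a i) ε ⊆ t' i := by
    have h1 : ∀ i ∈ I, ∀ᶠ ε : ℝ≥0∞ in 𝓝[>] 0, Metric.eball (Φ a i) ε ⊆ t' i := by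
      intro i _
      obtain ⟨δ, hδ, hsub⟩ := EMetric.mem_nhds_iff.1 (ht' i)
      filter_upwards [Ioo_mem_nhdsGT hδ] with ε hε
      exact (Metric.eball_subset_eball hε.2.le).trans hsub
    obtain ⟨ε, h2, h3⟩ := (((Filter.eventually_all_finite hI).2 h1).and self_mem_nhdsWithin).exists
    exact ⟨ε, h3, h2⟩
  obtain ⟨ε, hε0, hε⟩ := hε
  obtain ⟨b, hb, hab⟩ := h (hI.toFinset.image fun p => p.1⁻¹)
    (hI.toFinset.image fun p => p.2) ε hε0
  refine ⟨Φ b, hsub fun i hi => hε i hi ?_, mem_image_of_mem _ hb⟩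
  have hi' : i ∈ hI.toFinset := by simpa using hi
  have := hab i.1⁻¹ (Finset.mem_image_of_mem _ hi') i.2 (Finset.mem_image_of_mem _ hi')
  rw [Metric.mem_eball, MeasuredSets.edist_def]
  refine lt_of_eq_of_lt (measure_congr ?_) this
  have hc (c : ActionSpace Γ μ) : (Φ c i : Set X) =ᵐ[μ] c.act i.1⁻¹ ⁻¹' (i.2 : Set X) := by
    refine (MPAut.coe_image_ae_eq _ _).trans (Filter.EventuallyEq.of_eq ?_)
    change _ = (c.hom i.1⁻¹).rep ⁻¹' _
    rw [map_inv]
  exact (hc b).symmDiff (hc a)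

end ActionSpace

/-! ### Rigid actions have zero naive entropy -/

section Entropy

variable {X : Type*} [MeasurableSpace X] {μ : Measure X}

lemma tsum_measure_singleton {ι : Type*} [Countable ι] [MeasurableSpace ι]
    [MeasurableSingletonClass ι] (ρ : Measure ι) [IsProbabilityMeasure ρ] :
    ∑' i, ρ {i} = 1 := by
  have h := lintegral_countable' (μ := ρ) fun _ => (1 : ℝ≥0∞)
  simp only [lintegral_const, measure_univ, one_mul] at h
  exact h.symm

/-- Gibbs' inequality: coding a random variable by means of a wrong distribution costs at least
its entropy. -/
lemma shannonEntropy_le_lintegral_neg_log [IsProbabilityMeasure μ] {ι : Type*} [Countable ι]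
    [MeasurableSpace ι] [MeasurableSingletonClass ι] {Z : X → ι} (hZ : Measurable Z)
    (ρ : Measure ι) [IsProbabilityMeasure ρ] (hρ : ∀ᵐ x ∂μ, 0 < ρ.real {Z x}) :
    shannonEntropy μ Z ≤ ∫⁻ x, ENNReal.ofReal (-Real.log (ρ.real {Z x})) ∂μ := by
  have hp : ∀ i, μ.map Z {i} = ENNReal.ofReal (μ.real (Z ⁻¹' {i})) := fun i => by
    rw [Measure.map_apply hZ (measurableSet_singleton i), ofReal_measureReal]
  have hI : ∫⁻ x, ENNReal.ofReal (-Real.log (ρ.real {Z x})) ∂μ =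
      ∑' i, ENNReal.ofReal (-Real.log (ρ.real {i})) * ENNReal.ofReal (μ.real (Z ⁻¹' {i})) := by
    rw [← lintegral_map (f := fun i => ENNReal.ofReal (-Real.log (ρ.real {i})))
      (measurable_of_countable _) hZ, lintegral_countable']
    simp_rw [hp]
  have hsp : ∑' i, ENNReal.ofReal (μ.real (Z ⁻¹' {i})) = 1 := by
    have := (Measure.isProbabilityMeasure_map (μ := μ) hZ.aemeasurable)
    rw [← tsum_measure_singleton (μ.map Z)]
    exact tsum_congr fun i => (hp i).symm
  have hsq : ∑' i, ENNReal.ofReal (ρ.real {i}) = 1 := by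
    rw [← tsum_measure_singleton ρ]
    exact tsum_congr fun i => ofReal_measureReal
  -- Adding `p` and `q` to the two sides makes all terms of `p log (q / p) ≤ q - p` nonnegative.
  have hpt : ∀ i, ENNReal.ofReal (Real.negMulLog (μ.real (Z ⁻¹' {i}))) +
      ENNReal.ofReal (μ.real (Z ⁻¹' {i})) ≤
      ENNReal.ofReal (-Real.log (ρ.real {i})) * ENNReal.ofReal (μ.real (Z ⁻¹' {i})) +
      ENNReal.ofReal (ρ.real {i}) := by
    intro i
    rcases (measureReal_nonneg (μ := μ) (s := Z ⁻¹' {i})).eq_or_lt with h0 | hpos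
    · simp [← h0]
    have hq : 0 < ρ.real {i} := by
      by_contra hq
      have : μ (Z ⁻¹' {i}) = 0 := by
        refine measure_mono_null (fun x hx => ?_) hρ
        have hx' : Z x = i := hx
        simpa [hx'] using hq
      simp [Measure.real, this] at hpos
    have hq1 : ρ.real {i} ≤ 1 := measureReal_le_one
    have hp1 : μ.real (Z ⁻¹' {i}) ≤ 1 := measureReal_le_one
    have hlq : 0 ≤ -Real.log (ρ.real {i}) := neg_nonneg.2 (Real.log_nonpos hq.le hq1)
    rw [← ENNReal.ofReal_mul hlq, ← ENNReal.ofReal_add (Real.negMulLog_nonneg hpos.le hp1) hpos.le,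
      ← ENNReal.ofReal_add (mul_nonneg hlq hpos.le) hq.le]
    refine ENNReal.ofReal_le_ofReal ?_
    set p := μ.real (Z ⁻¹' {i})
    set q := ρ.real {i}
    have h1 := Real.log_le_sub_one_of_pos (div_pos hq hpos)
    rw [Real.log_div hq.ne' hpos.ne'] at h1
    have h2 : p * (Real.log q - Real.log p) ≤ p * (q / p - 1) := by gcongr
    have h3 : p * (q / p - 1) = q - p := by field_simp
    rw [Real.negMulLog]
    linarith
  have h := ENNReal.tsum_le_tsum hpt
  rw [ENNReal.tsum_add, ENNReal.tsum_add, hsp, hsq, ← hI] at h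
  exact (ENNReal.add_le_add_iff_right ENNReal.one_ne_top).1 h

/-- The information function of the partition of `X` into the fibres of `P`. -/
noncomputable def information {ι : Type*} (μ : Measure X) (P : X → ι) (x : X) : ℝ≥0∞ :=
  ENNReal.ofReal (-Real.log (μ.real (P ⁻¹' {P x})))

lemma lintegral_information [IsProbabilityMeasure μ] {P : X → ℕ} (hP : Measurable P) :
    ∫⁻ x, information μ P x ∂μ = shannonEntropy μ P := by
  unfold information shannonEntropy
  rw [← lintegral_map (f := fun i => ENNReal.ofReal (-Real.log (μ.real (P ⁻¹' {i}))))
      (measurable_of_countable _) hP, lintegral_countable']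
  refine tsum_congr fun i => ?_
  rw [Measure.map_apply hP (measurableSet_singleton i), ← ofReal_measureReal,
    ← ENNReal.ofReal_mul' measureReal_nonneg, Real.negMulLog]
  congr 1
  ring

lemma measurable_information {P : X → ℕ} (hP : Measurable P) : Measurable (information μ P) :=
  (measurable_of_countable fun i => ENNReal.ofReal (-Real.log (μ.real (P ⁻¹' {i})))).comp hP

lemma ae_measureReal_fiber_pos [IsProbabilityMeasure μ] (P : X → ℕ) :
    ∀ᵐ x ∂μ, 0 < μ.real (P ⁻¹' {P x}) := by
  have h : {x | ¬ 0 < μ.real (P ⁻¹' {P x})} ⊆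
      ⋃ i ∈ {i | μ (P ⁻¹' {i}) = 0}, P ⁻¹' {i} := by
    intro x hx
    simp only [mem_iUnion]
    refine ⟨P x, ?_, rfl⟩
    by_contra h0
    exact hx (ENNReal.toReal_pos h0 (measure_ne_top _ _))
  exact measure_mono_null h ((measure_biUnion_null_iff (to_countable _)).2 fun i hi => hi)

/-- If the maps `T t` move few points to another part of `P`, then the join of the partitions
`(T t)⁻¹ P` is cheap: encode first the part of `P` that contains the point, and then, for each `t`,
encode the label `P (T t x)` by a mixture of the point mass at `P x` and the distribution of `P`. -/
lemma shannonEntropy_pi_le [IsProbabilityMeasure μ] {P : X → ℕ} (hP : Measurable P) {W : Type*}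
    [Fintype W] {T : W → X → X} (hT : ∀ t, MeasurePreserving (T t) μ μ) {δ : ℝ} (hδ0 : 0 < δ)
    (hδ1 : δ < 1) :
    shannonEntropy μ (fun x t => P (T t x)) ≤ shannonEntropy μ P +
      ∑ t, (ENNReal.ofReal (-Real.log (1 - δ)) +
        ∫⁻ x in {x | P (T t x) ≠ P x},
          (ENNReal.ofReal (-Real.log δ) + information μ P (T t x)) ∂μ) := by
  set p : Measure ℕ := μ.map P with hp
  have : IsProbabilityMeasure p := Measure.isProbabilityMeasure_map hP.aemeasurable
  have hpi (i : ℕ) : p.real {i} = μ.real (P ⁻¹' {i}) := by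
    rw [Measure.real, hp, Measure.map_apply hP (measurableSet_singleton i)]; rfl
  let κ (j : ℕ) : Measure ℕ := ENNReal.ofReal (1 - δ) • Measure.dirac j + ENNReal.ofReal δ • p
  have hκ (j : ℕ) : IsProbabilityMeasure (κ j) := ⟨by
    simp only [κ, Measure.add_apply, Measure.smul_apply, measure_univ, smul_eq_mul, mul_one]
    rw [← ENNReal.ofReal_add (by linarith) hδ0.le]
    simp⟩
  let ρ : Measure (W → ℕ) := Measure.sum fun j => p {j} • Measure.pi fun _ => κ j
  have hρ : IsProbabilityMeasure ρ := ⟨by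
    rw [Measure.sum_apply _ MeasurableSet.univ]
    simp only [Measure.smul_apply, measure_univ, smul_eq_mul, mul_one]
    exact tsum_measure_singleton p⟩
  have hlow (j : ℕ) (w : W → ℕ) : p.real {j} * ∏ t, (κ j).real {w t} ≤ ρ.real {w} := by
    have h1 : p {j} * ∏ t, κ j {w t} ≤ ρ {w} := by
      rw [Measure.sum_apply _ (measurableSet_singleton w)]
      refine le_trans (le_of_eq ?_) (ENNReal.le_tsum j)
      rw [Measure.smul_apply, Measure.pi_singleton, smul_eq_mul]
    have h2 := ENNReal.toReal_mono (measure_ne_top ρ _) h1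
    rwa [ENNReal.toReal_mul, ENNReal.toReal_prod] at h2
  have hκeq (j : ℕ) : 1 - δ ≤ (κ j).real {j} := by
    refine (ENNReal.ofReal_le_iff_le_toReal (measure_ne_top _ _)).1 ?_
    simp only [κ, Measure.add_apply, Measure.smul_apply, smul_eq_mul]
    exact le_trans (by simp) le_self_add
  have hκne (i j : ℕ) : δ * p.real {i} ≤ (κ j).real {i} := by
    refine (ENNReal.ofReal_le_iff_le_toReal (measure_ne_top _ _)).1 ?_
    simp only [κ, Measure.add_apply, Measure.smul_apply, smul_eq_mul]
    rw [ENNReal.ofReal_mul hδ0.le, ofReal_measureReal]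
    exact le_add_self
  let c (t : W) (x : X) : ℝ≥0∞ := ENNReal.ofReal (-Real.log (1 - δ)) +
    {x | P (T t x) ≠ P x}.indicator
      (fun x => ENNReal.ofReal (-Real.log δ) + information μ P (T t x)) x
  have hgood : ∀ᵐ x ∂μ, 0 < p.real {P x} ∧ ∀ t, 0 < p.real {P (T t x)} := by
    simp only [hpi]
    refine (ae_measureReal_fiber_pos P).and (ae_all_iff.2 fun t => ?_)
    exact (hT t).quasiMeasurePreserving.ae (ae_measureReal_fiber_pos P)
  have hZ : Measurable fun x t => P (T t x) :=
    measurable_pi_lambda _ fun t => hP.comp (hT t).measurable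
  have hκpos {x : X} (hx : 0 < p.real {P x} ∧ ∀ t, 0 < p.real {P (T t x)}) (t : W) :
      0 < (κ (P x)).real {P (T t x)} := (mul_pos hδ0 (hx.2 t)).trans_le (hκne _ _)
  have hpos {x : X} (hx : 0 < p.real {P x} ∧ ∀ t, 0 < p.real {P (T t x)}) :
      0 < p.real {P x} * ∏ t, (κ (P x)).real {P (T t x)} :=
    mul_pos hx.1 (Finset.prod_pos fun t _ => hκpos hx t)
  have hcost : ∀ᵐ x ∂μ, ENNReal.ofReal (-Real.log (ρ.real {fun t => P (T t x)})) ≤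
      information μ P x + ∑ t, c t x := by
    filter_upwards [hgood] with x hx
    have hlog : -Real.log (ρ.real {fun t => P (T t x)}) ≤
        -Real.log (p.real {P x}) + ∑ t, -Real.log ((κ (P x)).real {P (T t x)}) := by
      have := Real.log_le_log (hpos hx) (hlow (P x) fun t => P (T t x))
      rw [Real.log_mul hx.1.ne' (Finset.prod_pos fun t _ => hκpos hx t).ne',
        Real.log_prod fun t _ => (hκpos hx t).ne'] at this
      rw [Finset.sum_neg_distrib]
      linarith
    refine (ENNReal.ofReal_le_ofReal hlog).trans (ENNReal.ofReal_add_le.trans ?_)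
    refine add_le_add (by rw [hpi]; rfl) ((Finset.le_sum_of_subadditive ENNReal.ofReal
      ENNReal.ofReal_zero.le (fun _ _ => ENNReal.ofReal_add_le) _ _).trans ?_)
    refine Finset.sum_le_sum fun t _ => ?_
    by_cases h : P (T t x) = P x
    · refine le_trans (ENNReal.ofReal_le_ofReal (neg_le_neg (Real.log_le_log (by linarith) ?_)))
        le_self_add
      rw [h]
      exact hκeq _
    · have hm : x ∈ {x | P (T t x) ≠ P x} := h
      refine le_trans ?_ le_add_self
      rw [indicator_of_mem hm, information, ← hpi]
      refine le_trans (ENNReal.ofReal_le_ofReal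
        (neg_le_neg (Real.log_le_log (mul_pos hδ0 (hx.2 t)) (hκne _ _)))) ?_
      rw [Real.log_mul hδ0.ne' (hx.2 t).ne', neg_add]
      exact ENNReal.ofReal_add_le
  have hD (t : W) : MeasurableSet {x | P (T t x) ≠ P x} :=
    (measurableSet_eq_fun (hP.comp (hT t).measurable) hP).compl
  have hcm (t : W) : Measurable fun x => ENNReal.ofReal (-Real.log δ) + information μ P (T t x) :=
    measurable_const.add ((measurable_information hP).comp (hT t).measurable)
  have hc (t : W) : Measurable (c t) := measurable_const.add ((hcm t).indicator (hD t))
  calc shannonEntropy μ (fun x t => P (T t x))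
      ≤ ∫⁻ x, ENNReal.ofReal (-Real.log (ρ.real {fun t => P (T t x)})) ∂μ :=
        shannonEntropy_le_lintegral_neg_log hZ ρ
          (hgood.mono fun x hx => (hpos hx).trans_le (hlow _ _))
    _ ≤ ∫⁻ x, information μ P x + ∑ t, c t x ∂μ := lintegral_mono_ae hcost
    _ = _ := by
        rw [lintegral_add_left (measurable_information hP), lintegral_information hP,
          lintegral_finsetSum _ fun t _ => hc t]
        congr 1
        refine Finset.sum_congr rfl fun t _ => ?_
        rw [lintegral_add_left measurable_const, lintegral_const, measure_univ, mul_one,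
          lintegral_indicator (hD t)]

/-- In the weak topology, a countable partition is almost fixed by the transformations near the
identity. -/
lemma MPAut.tendsto_measure_ne_nhds_one [IsFiniteMeasure μ] {P : X → ℕ} (hP : Measurable P) :
    Filter.Tendsto (fun T : MPAut μ => μ {x | P (T.rep x) ≠ P x}) (𝓝 1) (𝓝 0) := by
  have hA (i : ℕ) : Filter.Tendsto
      (fun T : MPAut μ => μ ((T.rep ⁻¹' (P ⁻¹' {i})) ∆ (P ⁻¹' {i}))) (𝓝 1) (𝓝 0) := by
    rw [Filter.tendsto_iff_comap, MPAut.nhds_one_eq]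
    exact iInf_le _ (⟨P ⁻¹' {i}, hP (measurableSet_singleton i)⟩ : MeasuredSets μ)
  have htail : Filter.Tendsto (fun m => μ {x | m ≤ P x}) Filter.atTop (𝓝 0) := by
    have h0 : ⋂ m, {x | m ≤ P x} = ∅ := by
      ext x
      simp only [mem_iInter, mem_ofPred_eq, mem_empty_iff_false, iff_false, not_forall]
      exact ⟨P x + 1, by omega⟩
    rw [← measure_empty (μ := μ), ← h0]
    exact tendsto_measure_iInter_atTop
      (fun m => (measurableSet_le measurable_const hP).nullMeasurableSet)
      (fun m n hmn x hx => le_trans hmn hx) ⟨0, measure_ne_top _ _⟩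
  rw [ENNReal.tendsto_nhds_zero]
  intro ε hε
  have hε2 : 0 < ε / 2 := ENNReal.half_pos hε.ne'
  obtain ⟨m, hm⟩ := ((ENNReal.tendsto_nhds_zero.1 htail) _ hε2).exists
  have hsum : Filter.Tendsto (fun T : MPAut μ => ∑ i ∈ Finset.range m,
      μ ((T.rep ⁻¹' (P ⁻¹' {i})) ∆ (P ⁻¹' {i}))) (𝓝 1) (𝓝 0) := by
    simpa using tendsto_finsetSum (Finset.range m) fun i _ => hA i
  filter_upwards [(ENNReal.tendsto_nhds_zero.1 hsum) _ hε2] with T hT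
  have hsub : {x | P (T.rep x) ≠ P x} ⊆
      (⋃ i ∈ Finset.range m, (T.rep ⁻¹' (P ⁻¹' {i})) ∆ (P ⁻¹' {i})) ∪ {x | m ≤ P x} := by
    intro x hx
    by_cases h : m ≤ P x
    · exact Or.inr h
    · refine Or.inl (mem_biUnion (x := P x) (by simpa using h) (Or.inr ⟨rfl, hx⟩))
  calc μ {x | P (T.rep x) ≠ P x} ≤ _ := measure_mono hsub
    _ ≤ _ := measure_union_le _ _
    _ ≤ ε / 2 + ε / 2 := by
        gcongr
        exact (measure_biUnion_finset_le _ _).trans hT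
    _ = ε := ENNReal.add_halves ε

/-- For a set `W` of `n + 1` elements that hardly move `P`, the entropy of the join is at most
`H(P) + (n + 1) ε`, and `H(P)` is negligible compared with `n + 1`. -/
lemma ActionSpace.IsRigid.naiveEntropyPartition_eq_zero [IsProbabilityMeasure μ] {Γ : Type*}
    [Group Γ] {a : ActionSpace Γ μ} (ha : a.IsRigid) {P : X → ℕ} (hP : Measurable P)
    (hfin : shannonEntropy μ P ≠ ⊤) : naiveEntropyPartition a P = 0 := by
  refine le_antisymm (ENNReal.le_of_forall_pos_le_add fun e he _ => ?_) zero_le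
  rw [zero_add]
  -- With `δ = 1 - exp (-e')`, a label that does not move costs `e'`.
  set e' : ℝ := e / 4 with he'
  have he'0 : 0 < e' := by positivity
  set δ : ℝ := 1 - Real.exp (-e') with hδ
  have hδ0 : 0 < δ := by
    rw [hδ, sub_pos, Real.exp_lt_one_iff]
    linarith
  have hδ1 : δ < 1 := by
    rw [hδ]
    linarith [Real.exp_pos (-e')]
  have hlogδ : -Real.log (1 - δ) = e' := by simp [hδ]
  set L : ℝ≥0∞ := ENNReal.ofReal (-Real.log δ) with hL
  have he'E : ENNReal.ofReal e' ≠ 0 := by simpa using he'0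
  obtain ⟨η, hη0, hη⟩ := exists_pos_setLIntegral_lt_of_measure_lt (μ := μ)
    (f := fun x => L + information μ P x) (by
      rw [lintegral_add_left measurable_const, lintegral_information hP]
      simp [hL, hfin]) he'E
  obtain ⟨n, hn⟩ : ∃ n : ℕ, shannonEntropy μ P / (n + 1 : ℕ) ≤ ENNReal.ofReal e' := by
    obtain ⟨n, hn0, hn⟩ := ENNReal.exists_nat_pos_mul_gt he'E hfin
    obtain ⟨k, rfl⟩ : ∃ k, n = k + 1 := ⟨n - 1, by omega⟩
    exact ⟨k, ENNReal.div_le_of_le_mul' hn.le⟩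
  have hU : {T : MPAut μ | μ {x | P (T.rep x) ≠ P x} < η} ∈ 𝓝 (1 : MPAut μ) :=
    (MPAut.tendsto_measure_ne_nhds_one hP).eventually_lt_const hη0
  obtain ⟨W, hW, hWc⟩ := (ha _ hU).exists_subset_card_eq (n + 1)
  have hWne : W.Nonempty := Finset.card_pos.1 (by omega)
  refine (iInf₂_le W hWne).trans ?_
  have hterm (t : W) : ∫⁻ x in {x | P (a.act t x) ≠ P x},
      (L + information μ P (a.act t x)) ∂μ ≤ ENNReal.ofReal e' := by
    have ht : μ {x | P (a.act t x) ≠ P x} < η := hW t.2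
    have hinv : a.act (t : Γ)⁻¹ ∘ a.act t =ᵐ[μ] id := by
      refine (a.act_mul _ _).symm.trans ?_
      change (a.hom ((t : Γ)⁻¹ * t)).rep =ᵐ[μ] id
      rw [inv_mul_cancel, _root_.map_one]
      exact MPAut.rep_one
    have hmt := a.measurePreserving_act (t : Γ)
    have hmt' := a.measurePreserving_act (t : Γ)⁻¹
    have hD : MeasurableSet {x | P (a.act t x) ≠ P x} :=
      (measurableSet_eq_fun (hP.comp hmt.measurable) hP).compl
    have hDeq : {x | P (a.act t x) ≠ P x} =ᵐ[μ]
        a.act t ⁻¹' (a.act (t : Γ)⁻¹ ⁻¹' {x | P (a.act t x) ≠ P x}) :=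
      (hinv.preimage {x | P (a.act t x) ≠ P x}).symm
    -- The set of moved points is a preimage under `t`, so the integral is one over a small set.
    rw [setLIntegral_congr hDeq,
      hmt.setLIntegral_comp_preimage (f := fun x => L + information μ P x) (hmt'.measurable hD)
        (measurable_const.add (measurable_information hP))]
    refine (hη _ ?_).le
    rwa [hmt'.measure_preimage hD.nullMeasurableSet]
  have hH : shannonEntropy μ (joinLabel a W P) ≤ shannonEntropy μ P +
      (n + 1 : ℕ) * (ENNReal.ofReal e' + ENNReal.ofReal e') := by
    refine (shannonEntropy_pi_le hP (T := fun t : W => a.act t)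
      (fun t => a.measurePreserving_act t) hδ0 hδ1).trans ?_
    gcongr
    rw [hlogδ]
    refine (Finset.sum_le_sum fun t _ => add_le_add le_rfl (hterm t)).trans ?_
    simp [hWc, mul_add]
  have hn0 : ((n + 1 : ℕ) : ℝ≥0∞) ≠ 0 := by simp
  rw [hWc]
  calc shannonEntropy μ (joinLabel a W P) / (n + 1 : ℕ)
      ≤ (shannonEntropy μ P + (n + 1 : ℕ) * (ENNReal.ofReal e' + ENNReal.ofReal e')) /
          (n + 1 : ℕ) := by gcongr
    _ = shannonEntropy μ P / (n + 1 : ℕ) + (ENNReal.ofReal e' + ENNReal.ofReal e') := by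
        rw [ENNReal.add_div, mul_comm, ENNReal.mul_div_cancel_right hn0 (by simp)]
    _ ≤ ENNReal.ofReal e' + (ENNReal.ofReal e' + ENNReal.ofReal e') := by gcongr
    _ ≤ e := by
        rw [← ENNReal.ofReal_add he'0.le he'0.le, ← ENNReal.ofReal_add he'0.le (by linarith),
          ← ENNReal.ofReal_coe_nnreal]
        exact ENNReal.ofReal_le_ofReal (by rw [he']; linarith [e.2])

lemma ActionSpace.IsRigid.naiveEntropy_eq_zero [IsProbabilityMeasure μ] {Γ : Type*}
    [Group Γ] {a : ActionSpace Γ μ} (ha : a.IsRigid) : naiveEntropy a = 0 := by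
  simp only [naiveEntropy, ENNReal.iSup_eq_zero]
  exact fun P hP hfin => ha.naiveEntropyPartition_eq_zero hP hfin

end Entropy

/-! ### Isomorphisms of Lebesgue spaces -/

section Isomorphism

variable {X : Type*} [MeasurableSpace X] [StandardBorelSpace X] {μ : Measure X}
  [IsProbabilityMeasure μ] [NullSingletonClass μ]

/-- The space is isomorphic to the plane, and only countably many of the vertical lines can have
positive measure. -/
lemma exists_measurableSet_null_not_countable (μ : Measure X) [IsProbabilityMeasure μ]
    [NullSingletonClass μ] : ∃ N : Set X, MeasurableSet N ∧ μ N = 0 ∧ ¬ N.Countable := by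
  have hX : ¬ Countable X := fun h => by
    have h0 : μ univ = 0 := (to_countable univ).measure_zero μ
    simp at h0
  have hR : ¬ Countable (ℝ × ℝ) := fun h => by
    have : Countable ℝ := (Prod.mk_left_injective (0 : ℝ)).countable
    exact not_countable (α := ℝ) this
  let e : X ≃ᵐ ℝ × ℝ := PolishSpace.measurableEquivOfNotCountable hX hR
  let F : ℝ → Set X := fun t => e ⁻¹' {p | p.1 = t}
  have hF (t : ℝ) : MeasurableSet (F t) :=
    e.measurable (measurable_fst (measurableSet_singleton t))
  have hdisj : Pairwise (Function.onFun Disjoint F) := fun s t hst =>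
    disjoint_left.2 fun x hs ht => hst (hs.symm.trans ht)
  have hc := Measure.countable_meas_pos_of_disjoint_iUnion (μ := μ) hF hdisj
  obtain ⟨t, ht⟩ : ∃ t, μ (F t) = 0 := by
    by_contra! h
    have : {i | 0 < μ (F i)} = univ := eq_univ_of_forall fun t => pos_iff_ne_zero.2 (h t)
    rw [this] at hc
    exact not_countable (α := ℝ) (countable_univ_iff.1 hc)
  refine ⟨F t, hF t, ht, fun hcount => ?_⟩
  have h1 : (range fun s : ℝ => e.symm (t, s)).Countable :=
    hcount.mono (range_subset_iff.2 fun s => by simp [F])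
  have h2 : Function.Injective fun s : ℝ => e.symm (t, s) :=
    e.symm.injective.comp (Prod.mk_right_injective t)
  exact not_countable (α := ℝ)
    (countable_univ_iff.1 (by simpa using (h1.preimage_of_injOn h2.injOn)))

/-- A measure-preserving map that is injective off a null set agrees almost everywhere with an
everywhere defined isomorphism: the exceptional sets can be enlarged to uncountable null sets, and
any two uncountable standard Borel spaces are isomorphic. -/
lemma exists_measurableEquiv_ae_eq {Y : Type*} [MeasurableSpace Y] [StandardBorelSpace Y]
    {ν : Measure Y} [IsProbabilityMeasure ν] [NullSingletonClass ν] {F : X → Y}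
    (hF : MeasurePreserving F μ ν) {Z : Set X} (hZ : MeasurableSet Z) (hZμ : μ Zᶜ = 0)
    (hinj : InjOn F Z) : ∃ e : X ≃ᵐ Y, MeasurePreserving e μ ν ∧ e =ᵐ[μ] F := by
  classical
  obtain ⟨N, hN, hNμ, hNc⟩ := exists_measurableSet_null_not_countable μ
  obtain ⟨N', hN', hNν, hNc'⟩ := exists_measurableSet_null_not_countable ν
  set Z₁ : Set X := Z \ (N ∪ F ⁻¹' N') with hZ₁
  have hZ₁m : MeasurableSet Z₁ := hZ.diff (hN.union (hF.measurable hN'))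
  have hZ₁μ : μ Z₁ᶜ = 0 := by
    have : Z₁ᶜ ⊆ Zᶜ ∪ (N ∪ F ⁻¹' N') := by
      intro x hx
      by_contra h
      simp only [mem_union, not_or, mem_compl_iff, not_not] at h
      exact hx ⟨h.1, by simpa using h.2⟩
    refine measure_mono_null this (measure_union_null hZμ (measure_union_null hNμ ?_))
    rw [hF.measure_preimage hN'.nullMeasurableSet, hNν]
  have : StandardBorelSpace Z₁ := hZ₁m.standardBorel
  have : StandardBorelSpace (Z₁ᶜ : Set X) := hZ₁m.compl.standardBorel
  let f : Z₁ → Y := fun z => F z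
  have hf : MeasurableEmbedding f := (hF.measurable.comp measurable_subtype_coe).measurableEmbedding
    fun x y hxy => Subtype.ext (hinj x.2.1 y.2.1 hxy)
  have hB : MeasurableSet (range f) := hf.measurableSet_range
  have : StandardBorelSpace ((range f)ᶜ : Set Y) := hB.compl.standardBorel
  have hc1 : ¬ Countable (Z₁ᶜ : Set X) := fun h =>
    hNc (Countable.mono (s₂ := Z₁ᶜ) (fun x hx hx' => hx'.2 (Or.inl hx)) (to_countable _))
  have hc2 : ¬ Countable ((range f)ᶜ : Set Y) := fun h =>
    hNc' (Countable.mono (s₂ := (range f)ᶜ) (fun y hy ⟨z, hz⟩ =>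
      z.2.2 (Or.inr (by rw [mem_preimage, show F z = y from hz]; exact hy))) (to_countable _))
  let e : X ≃ᵐ Y := (MeasurableEquiv.sumCompl hZ₁m).symm.trans
    ((MeasurableEquiv.sumCongr hf.equivRange
      (PolishSpace.measurableEquivOfNotCountable hc1 hc2)).trans (MeasurableEquiv.sumCompl hB))
  have heF : e =ᵐ[μ] F := by
    refine measure_mono_null (fun x hx => ?_) hZ₁μ
    intro hxZ
    apply hx
    change e x = F x
    have h1 : (MeasurableEquiv.sumCompl hZ₁m).symm x = Sum.inl ⟨x, hxZ⟩ :=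
      Equiv.sumCompl_symm_apply_of_pos hxZ
    simp only [e, MeasurableEquiv.trans_apply, h1]
    change ((hf.equivRange ⟨x, hxZ⟩ : range f) : Y) = F x
    rw [hf.equivRange_apply]
  exact ⟨e, ⟨e.measurable, (Measure.map_congr heF).trans hF.map_eq⟩, heF⟩

/-- The distribution function of a measure without atoms is uniformly distributed in `[0, 1]`. -/
lemma measure_cdf_le {m : Measure ℝ} [IsProbabilityMeasure m] [NullSingletonClass m] {c : ℝ}
    (hc0 : 0 ≤ c) (hc1 : c ≤ 1) :
    m {t | ProbabilityTheory.cdf m t ≤ c} = ENNReal.ofReal c := by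
  set G := ProbabilityTheory.cdf m with hG
  have hcont : Continuous G := by
    rw [continuous_iff_continuousAt]
    intro x
    rw [G.mono.continuousAt_iff_leftLim_eq_rightLim, G.rightLim_eq]
    have h1 : G.measure {x} = 0 := by
      rw [hG, ProbabilityTheory.measure_cdf]
      exact measure_singleton x
    rw [StieltjesFunction.measure_singleton, ENNReal.ofReal_eq_zero] at h1
    exact le_antisymm (G.mono.leftLim_le le_rfl) (by linarith)
  rcases hc1.eq_or_lt with rfl | hc1
  · have : {t | G t ≤ 1} = univ := eq_univ_of_forall fun t => ProbabilityTheory.cdf_le_one m t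
    rw [this]
    simp
  rcases ({t | G t ≤ c} : Set ℝ).eq_empty_or_nonempty with h0 | hne
  · rw [h0, measure_empty]
    have : c ≤ 0 := by
      by_contra hc
      obtain ⟨t, ht⟩ := ((ProbabilityTheory.tendsto_cdf_atBot m).eventually_lt_const
        (not_le.1 hc)).exists
      exact (h0 ▸ (show t ∈ {t | G t ≤ c} from ht.le) : t ∈ (∅ : Set ℝ))
    rw [ENNReal.ofReal_eq_zero.2 this]
  · have hclosed : IsClosed {t | G t ≤ c} := isClosed_le hcont continuous_const
    obtain ⟨b, hb⟩ := ((ProbabilityTheory.tendsto_cdf_atTop m).eventually_const_lt hc1).exists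
    have hbdd : BddAbove {t | G t ≤ c} := ⟨b, fun t ht => by
      by_contra h
      exact absurd (hb.trans_le (G.mono (not_le.1 h).le)) (not_lt.2 ht)⟩
    set t₁ := sSup {t | G t ≤ c} with ht₁
    have hmem : G t₁ ≤ c := hclosed.csSup_mem hne hbdd
    have heq : {t | G t ≤ c} = Iic t₁ := by
      ext t
      exact ⟨fun ht => le_csSup hbdd ht, fun ht => (G.mono ht).trans hmem⟩
    have hval : G t₁ = c := by
      by_contra h
      have hlt : G t₁ < c := lt_of_le_of_ne hmem h
      obtain ⟨t, ht, ht'⟩ := (((hcont.tendsto t₁).eventually_lt_const hlt).filter_mono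
        nhdsWithin_le_nhds |>.and (self_mem_nhdsWithin (s := Ioi t₁))).exists
      exact absurd (le_csSup hbdd (show t ∈ {t | G t ≤ c} from ht.le)) (not_le.2 ht')
    rw [heq, ← ProbabilityTheory.ofReal_cdf, ← hG, hval]

/-- Every Lebesgue space is isomorphic to the unit interval, and the isomorphism can be chosen so
as to map the parts of a given countable partition, in their order, to consecutive intervals. -/
theorem exists_measurableEquiv_unitInterval (μ : Measure X) [IsProbabilityMeasure μ]
    [NullSingletonClass μ] {P : X → ℕ} (hP : Measurable P) :
    ∃ e : X ≃ᵐ unitInterval, MeasurePreserving e μ volume ∧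
      ∀ i : ℕ, {x | P x ≤ i} =ᵐ[μ] e ⁻¹' {t | (t : ℝ) ≤ μ.real {x | P x ≤ i}} := by
  -- An injection into the reals that maps the part with label `i` into the interval `(i, i + 1)`.
  let f : X → ℝ := fun x => P x + Real.sigmoid (embeddingReal X x)
  have hfm : Measurable f := (measurable_from_top.comp hP).add
    (continuous_sigmoid.measurable.comp (measurable_embeddingReal X))
  have hflt (x : X) : f x < P x + 1 := by
    have := Real.sigmoid_lt_one (embeddingReal X x)
    simp only [f]; linarith
  have hfgt (x : X) : P x < f x := by
    have := Real.sigmoid_pos (embeddingReal X x)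
    simp only [f]; linarith
  have hfle (x : X) (i : ℕ) : f x ≤ i + 1 ↔ P x ≤ i := by
    constructor
    · intro h
      have : (P x : ℝ) < (i + 1 : ℕ) := by push_cast; exact (hfgt x).trans_le h
      exact Nat.lt_succ_iff.1 (by exact_mod_cast this)
    · intro h
      have : (P x : ℝ) ≤ i := by exact_mod_cast h
      linarith [hflt x]
  have hfinj : Function.Injective f := by
    intro x y hxy
    have hPxy : P x = P y := le_antisymm ((hfle x _).1 (hxy ▸ (hflt y).le))
      ((hfle y _).1 (hxy ▸ (hflt x).le))
    refine (measurableEmbedding_embeddingReal X).injective (Real.sigmoid_strictMono.injective ?_)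
    simp only [f, hPxy] at hxy
    linarith
  set m : Measure ℝ := μ.map f with hm
  have : IsProbabilityMeasure m := Measure.isProbabilityMeasure_map hfm.aemeasurable
  have : NullSingletonClass m := ⟨fun t => by
    rw [hm, Measure.map_apply hfm (measurableSet_singleton t)]
    exact (subsingleton_singleton.preimage hfinj).measure_zero μ⟩
  let G : ℝ → unitInterval := fun t =>
    ⟨ProbabilityTheory.cdf m t, ProbabilityTheory.cdf_nonneg m t, ProbabilityTheory.cdf_le_one m t⟩
  have hGmono : Monotone G := fun s t hst => (ProbabilityTheory.cdf m).mono hst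
  let F : X → unitInterval := G ∘ f
  have hFm : Measurable F := hGmono.measurable.comp hfm
  have hF : MeasurePreserving F μ volume := ⟨hFm, by
    have := Measure.isProbabilityMeasure_map (μ := μ) hFm.aemeasurable
    refine Measure.ext_of_Iic _ _ fun c => ?_
    rw [unitInterval.volume_Iic, ← measure_cdf_le (m := m) c.2.1 c.2.2, hm,
      Measure.map_apply hFm measurableSet_Iic, Measure.map_apply hfm]
    · rfl
    · exact hGmono.measurable measurableSet_Iic⟩
  -- Two points with the same image are separated by a rational, unless they are in the null set `B`.
  let B : Set X := ⋃ q : ℚ, F ⁻¹' {G q}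
  have hB : MeasurableSet B := .iUnion fun q => hFm (measurableSet_singleton _)
  have hBμ : μ B = 0 := measure_iUnion_null fun q => by
    rw [hF.measure_preimage (measurableSet_singleton _).nullMeasurableSet, measure_singleton]
  have hinj : InjOn F Bᶜ := by
    have key : ∀ x ∈ Bᶜ, ∀ y, F x = F y → ¬ f x < f y := by
      intro x hx y hxy hlt
      obtain ⟨q, hq1, hq2⟩ := exists_rat_btwn hlt
      exact hx (mem_iUnion.2 ⟨q, le_antisymm (hGmono hq1.le) ((hGmono hq2.le).trans hxy.ge)⟩)
    exact fun x hx y hy hxy => hfinj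
      (le_antisymm (not_lt.1 (key y hy x hxy.symm)) (not_lt.1 (key x hx y hxy)))
  obtain ⟨e, he, heF⟩ := exists_measurableEquiv_ae_eq hF hB.compl (by rwa [compl_compl]) hinj
  refine ⟨e, he, fun i => ?_⟩
  have hs : ProbabilityTheory.cdf m (i + 1) = μ.real {x | P x ≤ i} := by
    rw [ProbabilityTheory.cdf_eq_real, Measure.real, hm, Measure.map_apply hfm measurableSet_Iic,
      Measure.real]
    congr 2
    ext x
    exact hfle x i
  have hsub : {x | P x ≤ i} ⊆ F ⁻¹' Iic (G (i + 1)) := fun x hx => hGmono ((hfle x i).2 hx)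
  have hIic : {t : unitInterval | (t : ℝ) ≤ μ.real {x | P x ≤ i}} = Iic (G (i + 1)) := by
    ext t
    rw [← hs]
    rfl
  rw [hIic]
  have h1 : {x | P x ≤ i} =ᵐ[μ] F ⁻¹' Iic (G (i + 1)) := by
    refine ae_eq_of_subset_of_measure_ge hsub ?_
      (measurableSet_le hP measurable_const).nullMeasurableSet (measure_ne_top _ _)
    rw [hF.measure_preimage measurableSet_Iic.nullMeasurableSet, unitInterval.volume_Iic]
    change ENNReal.ofReal (ProbabilityTheory.cdf m (i + 1)) ≤ _
    rw [hs, ofReal_measureReal]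
  exact h1.trans (heF.symm.preimage _)

end Isomorphism

lemma volume_symmDiff_setOf_le_le (s t : ℝ) :
    (volume : Measure unitInterval) ({x | (x : ℝ) ≤ s} ∆ {x | (x : ℝ) ≤ t}) ≤
      ENNReal.ofReal |s - t| := by
  wlog hst : s ≤ t generalizing s t
  · rw [symmDiff_comm, abs_sub_comm]
    exact this t s (not_le.1 hst).le
  have hsub : ({x : unitInterval | (x : ℝ) ≤ s} ∆ {x | (x : ℝ) ≤ t}) ⊆ Subtype.val ⁻¹' Ioc s t := by
    rintro x (⟨h1, h2⟩ | ⟨h1, h2⟩)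
    · exact absurd (le_trans h1 hst) h2
    · exact ⟨not_le.1 h2, h1⟩
  calc _ ≤ (volume : Measure unitInterval) (Subtype.val ⁻¹' Ioc s t) := measure_mono hsub
    _ = (volume.restrict unitInterval) (Ioc s t) :=
      unitInterval.measurePreserving_coe.measure_preimage measurableSet_Ioc.nullMeasurableSet
    _ ≤ volume (Ioc s t) := Measure.restrict_apply_le _ _
    _ = ENNReal.ofReal |s - t| := by
      rw [Real.volume_Ioc, abs_sub_comm, abs_of_nonneg (by linarith)]

lemma measureReal_setOf_le_eq_sum {Z : Type*} [MeasurableSpace Z] (m : Measure Z)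
    [IsProbabilityMeasure m] {R : Z → ℕ} (hR : Measurable R) (i : ℕ) :
    m.real {x | R x ≤ i} = ∑ j ∈ Finset.range (i + 1), m.real (R ⁻¹' {j}) := by
  rw [← measureReal_biUnion_finset]
  · congr 1
    ext x
    simp
  · exact fun j _ k _ hjk => disjoint_left.2 fun x hx hx' => hjk (hx.symm.trans hx')
  · exact fun j _ => hR (measurableSet_singleton j)

lemma abs_measureReal_le_sub_le {X Y : Type*} [MeasurableSpace X] [MeasurableSpace Y]
    {μ : Measure X} {ν : Measure Y} [IsProbabilityMeasure μ] [IsProbabilityMeasure ν]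
    {P : X → ℕ} {Q : Y → ℕ} (hP : Measurable P) (hQ : Measurable Q)
    {d : ℝ} (h : ∀ i, |μ.real (P ⁻¹' {i}) - ν.real (Q ⁻¹' {i})| ≤ d) (i : ℕ) :
    |μ.real {x | P x ≤ i} - ν.real {y | Q y ≤ i}| ≤ (i + 1) * d := by
  rw [measureReal_setOf_le_eq_sum μ hP, measureReal_setOf_le_eq_sum ν hQ,
    ← Finset.sum_sub_distrib]
  refine (Finset.abs_sum_le_sum_abs _ _).trans ((Finset.sum_le_sum fun j _ => h j).trans ?_)
  simp

section Partition

variable {X Y : Type*} [MeasurableSpace X] [StandardBorelSpace X] [MeasurableSpace Y]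
  [StandardBorelSpace Y] {μ : Measure X} {ν : Measure Y} [IsProbabilityMeasure μ]
  [NullSingletonClass μ] [IsProbabilityMeasure ν] [NullSingletonClass ν]

/-- Two finite partitions of Lebesgue spaces whose parts have almost the same measures can almost
be mapped to each other by an isomorphism. Both spaces are identified with the unit interval so that
the parts become consecutive intervals, whose end points are then near each other. -/
theorem exists_measurableEquiv_measure_ne_le {ι : Type*} [Finite ι] [MeasurableSpace ι]
    [MeasurableSingletonClass ι] {P : X → ι} {Q : Y → ι} (hP : Measurable P) (hQ : Measurable Q)
    {d : ℝ} (h : ∀ i, |μ.real (P ⁻¹' {i}) - ν.real (Q ⁻¹' {i})| ≤ d) :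
    ∃ e : X ≃ᵐ Y, MeasurePreserving e μ ν ∧
      μ.real {x | P x ≠ Q (e x)} ≤ (Nat.card ι) ^ 2 * d := by
  let c : ι → ℕ := fun i => Finite.equivFin ι i
  have hc : Function.Injective c := Fin.val_injective.comp (Finite.equivFin ι).injective
  have hcm : Measurable c := measurable_of_countable c
  set M := Nat.card ι with hM
  have hd : 0 ≤ d := by
    obtain ⟨x⟩ := nonempty_of_isProbabilityMeasure μ
    exact (abs_nonneg _).trans (h (P x))
  obtain ⟨e₁, he₁, h₁⟩ := exists_measurableEquiv_unitInterval μ (hcm.comp hP)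
  obtain ⟨e₂, he₂, h₂⟩ := exists_measurableEquiv_unitInterval ν (hcm.comp hQ)
  have he : MeasurePreserving (e₁.trans e₂.symm) μ ν := (he₂.symm e₂).comp he₁
  refine ⟨e₁.trans e₂.symm, he, ?_⟩
  have hpre : ∀ j : ℕ, |μ.real ((c ∘ P) ⁻¹' {j}) - ν.real ((c ∘ Q) ⁻¹' {j})| ≤ d := by
    intro j
    by_cases hj : ∃ i, c i = j
    · obtain ⟨i, rfl⟩ := hj
      simp only [preimage_comp]
      rw [show c ⁻¹' {c i} = {i} from by ext k; exact hc.eq_iff]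
      exact h i
    · have : c ⁻¹' {j} = ∅ := by
        ext k
        simp only [mem_preimage, mem_singleton_iff, mem_empty_iff_false, iff_false]
        exact fun hk => hj ⟨k, hk⟩
      simp only [preimage_comp, this]
      simpa using hd
  have hstep (i : ℕ) (hi : i < M) :
      μ.real ({x | (c ∘ P) x ≤ i} ∆ {x | (c ∘ Q) ((e₁.trans e₂.symm) x) ≤ i}) ≤ M * d := by
    have hQi : {x | (c ∘ Q) ((e₁.trans e₂.symm) x) ≤ i} =ᵐ[μ]
        e₁ ⁻¹' {t | (t : ℝ) ≤ ν.real {y | (c ∘ Q) y ≤ i}} := by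
      have h3 := he.quasiMeasurePreserving.preimage_ae_eq (h₂ i)
      refine h3.trans (Filter.EventuallyEq.of_eq ?_)
      ext x
      simp
    have hm1 (s : ℝ) : MeasurableSet {t : unitInterval | (t : ℝ) ≤ s} :=
      measurableSet_le measurable_subtype_coe measurable_const
    have h4 : μ ({x | (c ∘ P) x ≤ i} ∆ {x | (c ∘ Q) ((e₁.trans e₂.symm) x) ≤ i}) ≤
        ENNReal.ofReal (M * d) := by
      rw [measure_congr ((h₁ i).symmDiff hQi), ← preimage_symmDiff,
        he₁.measure_preimage ((hm1 _).symmDiff (hm1 _)).nullMeasurableSet]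
      refine (volume_symmDiff_setOf_le_le _ _).trans (ENNReal.ofReal_le_ofReal ?_)
      refine (abs_measureReal_le_sub_le (hcm.comp hP) (hcm.comp hQ) hpre i).trans ?_
      have : ((i : ℝ) + 1) ≤ M := by exact_mod_cast hi
      gcongr
    exact ENNReal.toReal_le_of_le_ofReal (by positivity) h4
  have hsub : {x | P x ≠ Q ((e₁.trans e₂.symm) x)} ⊆ ⋃ i ∈ Finset.range M,
      ({x | (c ∘ P) x ≤ i} ∆ {x | (c ∘ Q) ((e₁.trans e₂.symm) x) ≤ i}) := by
    intro x hx
    have hlt (i : ι) : c i < M := (Finite.equivFin ι i).2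
    rcases lt_or_gt_of_ne (hc.ne hx) with hlt' | hlt'
    · exact mem_biUnion (x := c (P x)) (by simpa using hlt _)
        (Or.inl ⟨le_refl (c (P x)), not_le.2 hlt'⟩)
    · exact mem_biUnion (x := c (Q ((e₁.trans e₂.symm) x))) (by simpa using hlt _)
        (Or.inr ⟨le_refl (c (Q ((e₁.trans e₂.symm) x))), not_le.2 hlt'⟩)
  calc μ.real {x | P x ≠ Q ((e₁.trans e₂.symm) x)} ≤ _ := measureReal_mono hsub (measure_ne_top _ _)
    _ ≤ _ := measureReal_biUnion_finset_le _ _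
    _ ≤ ∑ i ∈ Finset.range M, M * d :=
      Finset.sum_le_sum fun i hi => hstep i (Finset.mem_range.1 hi)
    _ = _ := by simp; ring

end Partition

/-! ### Transport of actions -/

namespace MPTrans

variable {X Y : Type*} [MeasurableSpace X] [MeasurableSpace Y] {μ : Measure X} {ν : Measure Y}

/-- Conjugation of transformations by an isomorphism. -/
def conj (e : X ≃ᵐ Y) (he : MeasurePreserving e μ ν) : MPTrans ν →* MPTrans μ where
  toFun T := ⟨e.toEquiv.trans ((T.1 : Equiv.Perm Y).trans e.symm.toEquiv),
    (he.symm e).comp (T.2.1.comp he), (he.symm e).comp (T.2.2.comp he)⟩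
  map_one' := Subtype.ext (Equiv.ext fun x => e.symm_apply_apply x)
  map_mul' S T := Subtype.ext (Equiv.ext fun x => by
    change e.symm (S.map (T.map (e x))) = e.symm (S.map (e (e.symm (T.map (e x)))))
    rw [e.apply_symm_apply])

lemma continuous_conj (e : X ≃ᵐ Y) (he : MeasurePreserving e μ ν) : Continuous (conj e he) := by
  refine isInducing_image.continuous_iff.2 (continuous_pi fun A => ?_)
  let B : MeasuredSets ν := ⟨e.symm ⁻¹' (A : Set X), e.symm.measurable A.2⟩
  have h : ∀ S T : MPTrans ν, edist ((conj e he S).image A) ((conj e he T).image A) =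
      edist (S.image B) (T.image B) := by
    intro S T
    have hm (T : MPTrans ν) : ((conj e he T).image A : Set X) = e ⁻¹' (T.image B : Set Y) := by
      rw [coe_image, coe_image, ← map_inv]
      rfl
    rw [MeasuredSets.edist_def, MeasuredSets.edist_def, hm, hm, ← preimage_symmDiff]
    have hSm : MeasurableSet ((S.image B : Set Y) ∆ (T.image B : Set Y)) :=
      (S.image B).2.symmDiff (T.image B).2
    exact he.measure_preimage hSm.nullMeasurableSet
  rw [continuous_iff_continuousAt]
  intro T
  have hT := (continuous_image B).tendsto T
  rw [nhds_eq_comap_edist, Filter.tendsto_comap_iff] at hT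
  rw [ContinuousAt, nhds_eq_comap_edist, Filter.tendsto_comap_iff]
  refine hT.congr fun S => (h S T).symm

/-- The product of a transformation with the identity. -/
noncomputable def prodId {Z : Type*} [MeasurableSpace Z] (ρ : Measure Z) [SFinite ν] [SFinite ρ] :
    MPTrans ν →* MPTrans (ν.prod ρ) where
  toFun T := ⟨Equiv.prodCongr (T.1 : Equiv.Perm Y) (Equiv.refl Z),
    T.2.1.prod (MeasurePreserving.id ρ), T.2.2.prod (MeasurePreserving.id ρ)⟩
  map_one' := rfl
  map_mul' _ _ := rfl

end MPTrans

namespace MPAut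

variable {X Y : Type*} [MeasurableSpace X] [MeasurableSpace Y] {μ : Measure X} {ν : Measure Y}

/-- Conjugation of elements of the automorphism group by an isomorphism. -/
def conj (e : X ≃ᵐ Y) (he : MeasurePreserving e μ ν) : MPAut ν →* MPAut μ :=
  QuotientGroup.map _ _ (MPTrans.conj e he) fun T hT => by
    change (MPTrans.conj e he T).map =ᵐ[μ] id
    have h : T.map ∘ e =ᵐ[μ] id ∘ e := he.quasiMeasurePreserving.ae_eq_comp hT
    have h2 := h.fun_comp e.symm
    rwa [Function.id_comp, show e.symm ∘ e = id from funext e.symm_apply_apply] at h2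

lemma conj_mk (e : X ≃ᵐ Y) (he : MeasurePreserving e μ ν) (T : MPTrans ν) :
    conj e he (T : MPAut ν) = (MPTrans.conj e he T : MPAut μ) := rfl

lemma rep_conj (e : X ≃ᵐ Y) (he : MeasurePreserving e μ ν) (T : MPAut ν) :
    (conj e he T).rep =ᵐ[μ] e.symm ∘ T.rep ∘ e := by
  conv_lhs => rw [← mk_out T, conj_mk]
  exact rep_mk _

lemma continuous_conj (e : X ≃ᵐ Y) (he : MeasurePreserving e μ ν) : Continuous (conj e he) :=
  (QuotientGroup.isQuotientMap_mk _).continuous_iff.2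
    (continuous_mk.comp (MPTrans.continuous_conj e he))

/-- The product of an element of the automorphism group with the identity. -/
noncomputable def prodId {Z : Type*} [MeasurableSpace Z] (ρ : Measure Z) [SFinite ν] [SFinite ρ] :
    MPAut ν →* MPAut (ν.prod ρ) :=
  QuotientGroup.map _ _ (MPTrans.prodId ρ) fun T hT => by
    change (MPTrans.prodId ρ T).map =ᵐ[ν.prod ρ] id
    have h : (T.map ∘ Prod.fst) =ᵐ[ν.prod ρ] (id ∘ Prod.fst : Y × Z → Y) :=
      Measure.quasiMeasurePreserving_fst.ae_eq_comp hT
    filter_upwards [h] with z hz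
    exact Prod.ext hz rfl

lemma rep_prodId {Z : Type*} [MeasurableSpace Z] (ρ : Measure Z) [SFinite ν] [SFinite ρ]
    (T : MPAut ν) : ∀ᵐ z ∂(ν.prod ρ), (prodId ρ T).rep z = (T.rep z.1, z.2) := by
  have h : prodId ρ T = (MPTrans.prodId ρ (Quotient.out T) : MPTrans (ν.prod ρ)) := by
    conv_lhs => rw [← mk_out T]
    rfl
  rw [h]
  exact rep_mk _

end MPAut

namespace ActionSpace

variable {Γ : Type*} [Group Γ] {X Y : Type*} [MeasurableSpace X] [MeasurableSpace Y]
  {μ : Measure X} {ν : Measure Y}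

/-- The transport of an action by an isomorphism. -/
def conj (e : X ≃ᵐ Y) (he : MeasurePreserving e μ ν) (b : ActionSpace Γ ν) : ActionSpace Γ μ :=
  (MPAut.conj e he).comp b.hom

lemma act_conj (e : X ≃ᵐ Y) (he : MeasurePreserving e μ ν) (b : ActionSpace Γ ν) (g : Γ) :
    (b.conj e he).act g =ᵐ[μ] e.symm ∘ b.act g ∘ e := MPAut.rep_conj e he _

lemma continuous_conj (e : X ≃ᵐ Y) (he : MeasurePreserving e μ ν) :
    Continuous (conj (Γ := Γ) e he) :=
  continuous_induced_rng.2 (continuous_pi fun g =>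
    (MPAut.continuous_conj e he).comp (continuous_apply g))

lemma ext_act {a b : ActionSpace Γ μ} (h : ∀ g, a.act g =ᵐ[μ] b.act g) : a = b :=
  MonoidHom.ext fun g => MPAut.ext_rep (h g)

lemma conj_surjective (e : X ≃ᵐ Y) (he : MeasurePreserving e μ ν) :
    Function.Surjective (conj (Γ := Γ) e he) := fun a => by
  refine ⟨a.conj e.symm (he.symm e), ext_act fun g => ?_⟩
  have h := (act_conj e he (a.conj e.symm (he.symm e)) g)
  have h2 := he.quasiMeasurePreserving.ae_eq_comp (act_conj e.symm (he.symm e) a g)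
  refine h.trans ((h2.fun_comp e.symm).trans (Filter.EventuallyEq.of_eq ?_))
  funext x
  simp

lemma IsRigid.conj {b : ActionSpace Γ ν} (hb : b.IsRigid) (e : X ≃ᵐ Y)
    (he : MeasurePreserving e μ ν) : (b.conj e he).IsRigid := fun _ hU =>
  hb _ ((MPAut.continuous_conj e he).tendsto' 1 1 (map_one _) hU)

end ActionSpace

/-! ### A criterion for density of rigid actions -/

namespace ActionSpace

variable {Γ : Type*} [Group Γ] {X : Type*} [MeasurableSpace X] {μ : Measure X}

lemma act_one (a : ActionSpace Γ μ) : a.act 1 =ᵐ[μ] id := by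
  change (a.hom 1).rep =ᵐ[μ] id
  rw [_root_.map_one]
  exact MPAut.rep_one

/-- Neighbourhoods in the space of actions can be tested on finite labels instead of sets. -/
lemma mem_closure_isRigid_of_labels [IsProbabilityMeasure μ] {a : ActionSpace Γ μ}
    (h : ∀ (M : ℕ) (P : X → Fin M), Measurable P → ∀ (K : Finset Γ) (ε : ℝ), 0 < ε →
      ∃ b : ActionSpace Γ μ, b.IsRigid ∧
        ∀ g ∈ K, μ.real {x | P (b.act g x) ≠ P (a.act g x)} < ε) :
    a ∈ closure {b : ActionSpace Γ μ | b.IsRigid} := by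
  classical
  refine mem_closure_of_forall fun K 𝒜 ε hε => ?_
  obtain ⟨r, hr0, hr⟩ := ENNReal.lt_iff_exists_nnreal_btwn.1 hε
  -- The common refinement of the sets in `𝒜`.
  let P₀ : X → (𝒜 → Bool) := fun x A => decide (x ∈ (A : MeasuredSets μ))
  have hP₀ : Measurable P₀ := measurable_pi_lambda _ fun A =>
    measurable_to_bool (by
      have : (fun x => decide (x ∈ (A : MeasuredSets μ))) ⁻¹' {true} = (A : Set X) := by
        ext x; simp
      rw [this]
      exact A.1.2)
  let c := Fintype.equivFin (𝒜 → Bool)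
  obtain ⟨b, hb, hab⟩ := h _ (c ∘ P₀) ((measurable_of_countable c).comp hP₀) K r
    (by exact_mod_cast hr0)
  refine ⟨b, hb, fun g hg A hA => lt_of_le_of_lt ?_ hr⟩
  have hsub : ((b.act g ⁻¹' (A : Set X)) ∆ (a.act g ⁻¹' (A : Set X))) ⊆
      {x | (c ∘ P₀) (b.act g x) ≠ (c ∘ P₀) (a.act g x)} := by
    intro x hx heq
    have h1 : decide (b.act g x ∈ A) = decide (a.act g x ∈ A) :=
      congrFun (c.injective heq) ⟨A, hA⟩
    rw [decide_eq_decide] at h1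
    rcases hx with hx | hx
    · exact hx.2 (h1.1 hx.1)
    · exact hx.2 (h1.2 hx.1)
  refine (measure_mono hsub).trans ?_
  rw [← ofReal_measureReal, ← ENNReal.ofReal_coe_nnreal]
  exact ENNReal.ofReal_le_ofReal (hab g hg).le

/-- If a label `Q` on `Y` has almost the same joint distribution along the action `b` as the label
`P` on `X` along the action `a`, then `b` has a conjugate that moves `P` almost as `a` does. -/
lemma exists_conj_near {Y : Type*} [MeasurableSpace Y] [StandardBorelSpace X]
    [StandardBorelSpace Y] [IsProbabilityMeasure μ] [NullSingletonClass μ] {ν : Measure Y}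
    [IsProbabilityMeasure ν] [NullSingletonClass ν] (a : ActionSpace Γ μ) (b : ActionSpace Γ ν)
    {M : ℕ} {P : X → Fin M} {Q : Y → Fin M} (hP : Measurable P) (hQ : Measurable Q)
    {K : Finset Γ} (hK : 1 ∈ K) {d : ℝ}
    (h : ∀ w : K → Fin M, |μ.real {x | ∀ g : K, P (a.act g x) = w g} -
      ν.real {y | ∀ g : K, Q (b.act g y) = w g}| ≤ d) :
    ∃ (e : X ≃ᵐ Y) (he : MeasurePreserving e μ ν), ∀ g ∈ K,
      μ.real {x | P ((b.conj e he).act g x) ≠ P (a.act g x)} ≤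
        2 * ((Nat.card (K → Fin M)) ^ 2 * d) := by
  have hPK : Measurable fun x (g : K) => P (a.act g x) :=
    measurable_pi_lambda _ fun g => hP.comp (a.measurePreserving_act g).measurable
  have hQK : Measurable fun y (g : K) => Q (b.act g y) :=
    measurable_pi_lambda _ fun g => hQ.comp (b.measurePreserving_act g).measurable
  obtain ⟨e, he, hD⟩ := exists_measurableEquiv_measure_ne_le (μ := μ) (ν := ν) hPK hQK (d := d)
    fun w => by
      refine le_of_eq_of_le ?_ (h w)
      congr 3 <;> · ext z; exact funext_iff
  set D : Set X := {x | (fun g : K => P (a.act g x)) ≠ fun g : K => Q (b.act g (e x))} with hDdef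
  have hDm : MeasurableSet D := (measurableSet_eq_fun hPK (hQK.comp e.measurable)).compl
  refine ⟨e, he, fun g hg => ?_⟩
  set b' := b.conj e he with hb'
  have hb'm := b'.measurePreserving_act g
  -- The coordinate of the joint labels at the identity of the group compares `P` with `Q ∘ e`.
  have hD' : ∀ᵐ x ∂μ, x ∉ D → P x = Q (e x) := by
    have h1 := he.quasiMeasurePreserving.ae_eq_comp b.act_one
    filter_upwards [a.act_one, h1] with x hx1 hx2 hxD
    have h2 := congrFun (not_not.1 hxD) ⟨1, hK⟩
    simp only [Function.comp_apply, id] at hx1 hx2 h2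
    rwa [hx1, hx2] at h2
  have hsub : ({x | P (b'.act g x) ≠ P (a.act g x)} : Set X) ≤ᵐ[μ] (D ∪ b'.act g ⁻¹' D : Set X) := by
    filter_upwards [hb'm.quasiMeasurePreserving.ae hD', act_conj e he b g] with x hx1 hx2 hx
    by_contra hn
    have hn' : x ∉ D ∧ b'.act g x ∉ D := not_or.1 hn
    apply hx
    have h2 := congrFun (not_not.1 hn'.1) ⟨g, hg⟩
    simp only at h2
    rw [hx1 hn'.2, h2, hx2]
    simp
  have hmono : μ.real {x | P (b'.act g x) ≠ P (a.act g x)} ≤ μ.real (D ∪ b'.act g ⁻¹' D) :=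
    ENNReal.toReal_mono (measure_ne_top _ _) (measure_mono_ae hsub)
  have hpre : μ.real (b'.act g ⁻¹' D) = μ.real D := by
    rw [Measure.real, hb'm.measure_preimage hDm.nullMeasurableSet, Measure.real]
  calc _ ≤ _ := hmono
    _ ≤ μ.real D + μ.real (b'.act g ⁻¹' D) := measureReal_union_le _ _
    _ ≤ _ := by rw [hpre, two_mul]; exact add_le_add hD hD

/-- An action is a limit of rigid actions if the joint distributions of its finite labels can be
approximated along actions with infinite kernel. -/
theorem mem_closure_isRigid_of_forall_exists_infinite_ker [StandardBorelSpace X]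
    [IsProbabilityMeasure μ] [NullSingletonClass μ] {a : ActionSpace Γ μ}
    (h : ∀ (M : ℕ) (P : X → Fin M), Measurable P → ∀ (K : Finset Γ) (d : ℝ), 0 < d →
      ∃ (Y : Type w) (_ : MeasurableSpace Y) (_ : StandardBorelSpace Y) (ν : Measure Y)
        (_ : IsProbabilityMeasure ν) (b : ActionSpace Γ ν) (Q : Y → Fin M),
        {g | b.hom g = 1}.Infinite ∧ Measurable Q ∧
        ∀ w : K → Fin M, |μ.real {x | ∀ g : K, P (a.act g x) = w g} -
          ν.real {y | ∀ g : K, Q (b.act g y) = w g}| ≤ d) :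
    a ∈ closure {b : ActionSpace Γ μ | b.IsRigid} := by
  classical
  refine mem_closure_isRigid_of_labels fun M P hP K ε hε => ?_
  let C : ℝ := 2 * (Nat.card (↥(insert 1 K) → Fin M) : ℝ) ^ 2
  obtain ⟨Y, _, _, ν, _, b, Q, hb, hQ, hlaw⟩ := h M P hP (insert 1 K) (ε / (C + 1)) (by positivity)
  -- Multiplying with the trivial action on the unit interval removes the atoms of `ν`.
  let b' : ActionSpace Γ (ν.prod (volume : Measure unitInterval)) := (MPAut.prodId volume).comp b.hom
  have hb'act (g : Γ) : ∀ᵐ z ∂(ν.prod (volume : Measure unitInterval)),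
      b'.act g z = (b.act g z.1, z.2) := MPAut.rep_prodId _ _
  have hb' : b'.IsRigid := .of_infinite_ker (hb.mono fun g hg => by
    change MPAut.prodId volume (b.hom g) = 1
    rw [show b.hom g = 1 from hg, _root_.map_one])
  have hna : NullSingletonClass (ν.prod (volume : Measure unitInterval)) := ⟨fun z => by
    rw [← singleton_prod_singleton (a := z.1) (b := z.2), Measure.prod_prod,
      measure_singleton (μ := volume), mul_zero]⟩
  obtain ⟨e, he, hnear⟩ := exists_conj_near a b' hP (hQ.comp measurable_fst)
    (Finset.mem_insert_self 1 K) (d := ε / (C + 1)) fun w => by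
      have h1 : (ν.prod (volume : Measure unitInterval)).real
          {z | ∀ g : ↥(insert 1 K), (Q ∘ Prod.fst) (b'.act g z) = w g} =
          ν.real {y | ∀ g : ↥(insert 1 K), Q (b.act g y) = w g} := by
        have h2 : {z | ∀ g : ↥(insert 1 K), (Q ∘ Prod.fst) (b'.act g z) = w g}
            =ᵐ[ν.prod (volume : Measure unitInterval)]
            Prod.fst ⁻¹' {y | ∀ g : ↥(insert 1 K), Q (b.act g y) = w g} := by
          filter_upwards [ae_all_iff.2 fun g : ↥(insert 1 K) => hb'act g] with z hz
          refine propext (forall_congr' fun g => ?_)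
          rw [hz g]
          rfl
        have hm : MeasurableSet {y | ∀ g : ↥(insert 1 K), Q (b.act g y) = w g} := by
          rw [ofPred_forall]
          exact .iInter fun g => (hQ.comp (b.measurePreserving_act g).measurable)
            (measurableSet_singleton (w g))
        rw [measureReal_congr h2, Measure.real,
          measurePreserving_fst.measure_preimage hm.nullMeasurableSet, Measure.real]
      rw [h1]
      exact hlaw w
  refine ⟨b'.conj e he, hb'.conj e he,
    fun g hg => (hnear g (Finset.mem_insert_of_mem hg)).trans_lt ?_⟩
  have hC : 0 ≤ C := by positivity
  calc 2 * ((Nat.card (↥(insert 1 K) → Fin M) : ℝ) ^ 2 * (ε / (C + 1)))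
      = C * (ε / (C + 1)) := by ring
    _ < (C + 1) * (ε / (C + 1)) := by gcongr; linarith
    _ = ε := by field_simp

end ActionSpace

/-! ### Groups whose finitely supported invariant measures are dense -/

section FiniteSupport

/-- Finitely many labels can be encoded as points of the Cantor set and recovered continuously. -/
lemma exists_locallyConstant_cantorSet (M : ℕ) [NeZero M] :
    ∃ (j : Fin M → cantorSet) (q : cantorSet → Fin M), Continuous q ∧ ∀ i, q (j i) = i := by
  let r : Fin M → (Fin M → Bool) := fun i k => decide (k = i)
  have hr : Function.Injective r := fun i k h => by
    have := congrFun h i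
    simpa [r] using this
  refine ⟨fun i => cantorSetHomeomorphNatToBool.symm fun n => decide (n = i),
    fun c => Function.invFun r fun k => cantorSetHomeomorphNatToBool c k, ?_, fun i => ?_⟩
  · exact (continuous_of_discreteTopology (f := Function.invFun r)).comp (continuous_pi fun k =>
      (continuous_apply _).comp cantorSetHomeomorphNatToBool.continuous)
  · simp only [Homeomorph.apply_symm_apply]
    refine Eq.trans (congrArg _ ?_) (Function.leftInverse_invFun hr i)
    funext k
    simp [r, Fin.ext_iff]

variable {Γ : Type*} [Group Γ]

lemma measurable_cantorShift (g : Γ) : Measurable (cantorShift g) :=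
  measurable_pi_lambda _ fun _ => measurable_pi_apply _

lemma cantorShift_mul (g h : Γ) (x : Γ → cantorSet) :
    cantorShift (g * h) x = cantorShift g (cantorShift h x) := by
  funext f
  simp [cantorShift, mul_assoc]

lemma cantorShift_one (x : Γ → cantorSet) : cantorShift (1 : Γ) x = x := by
  funext f
  simp [cantorShift]

/-- The shift as a homomorphism to the transformations of `(𝒞^Γ, ν)`, for an invariant `ν`. -/
def shiftTrans (ν : Measure (Γ → cantorSet)) (hν : ∀ g : Γ, ν.map (cantorShift g) = ν) :
    Γ →* MPTrans ν where
  toFun g := ⟨⟨cantorShift g, cantorShift g⁻¹,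
      fun x => by rw [← cantorShift_mul, inv_mul_cancel, cantorShift_one],
      fun x => by rw [← cantorShift_mul, mul_inv_cancel, cantorShift_one]⟩,
    ⟨measurable_cantorShift g, hν g⟩, ⟨measurable_cantorShift g⁻¹, hν g⁻¹⟩⟩
  map_one' := Subtype.ext (Equiv.ext fun x => cantorShift_one x)
  map_mul' g h := Subtype.ext (Equiv.ext fun x => cantorShift_mul g h x)

lemma map_shiftTrans (ν : Measure (Γ → cantorSet)) (hν : ∀ g : Γ, ν.map (cantorShift g) = ν)
    (g : Γ) : (shiftTrans ν hν g).map = cantorShift g := rfl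

/-- An infinite group that preserves a finitely supported measure permutes its finitely many atoms,
so infinitely many elements act trivially. -/
lemma infinite_setOf_shift_eq_one [Countable Γ] [Infinite Γ] (ν : Measure (Γ → cantorSet))
    (hν : ∀ g : Γ, ν.map (cantorShift g) = ν) {S : Set (Γ → cantorSet)} (hS : S.Finite)
    (hSν : ν Sᶜ = 0) : {g : Γ | (shiftTrans ν hν g : MPAut ν) = 1}.Infinite := by
  let A : Set (Γ → cantorSet) := {y | ν {y} ≠ 0}
  have hAS : A ⊆ S := fun y hy => by
    by_contra hyS
    exact hy (measure_mono_null (singleton_subset_iff.2 hyS) hSν)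
  have hAν : ν Aᶜ = 0 := by
    refine measure_mono_null (t := Sᶜ ∪ ⋃ y ∈ S ∩ Aᶜ, {y}) (fun y hy => ?_) ?_
    · by_cases hyS : y ∈ S
      · exact Or.inr (mem_biUnion (show y ∈ S ∩ Aᶜ from ⟨hyS, hy⟩) rfl)
      · exact Or.inl hyS
    · refine measure_union_null hSν ((measure_biUnion_null_iff (hS.inter_of_left _).countable).2 ?_)
      exact fun y hy => not_not.1 hy.2
  have hA (g : Γ) {y : Γ → cantorSet} (hy : y ∈ A) : cantorShift g y ∈ A := by
    have h1 : ν {cantorShift g y} = ν {y} := by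
      conv_lhs => rw [← hν g]
      rw [Measure.map_apply (measurable_cantorShift g) (measurableSet_singleton _)]
      congr 1
      ext z
      exact ((shiftTrans ν hν g).1 : Equiv.Perm (Γ → cantorSet)).injective.eq_iff
    change ν {cantorShift g y} ≠ 0
    rw [h1]
    exact hy
  have : Finite A := (hS.subset hAS).to_subtype
  obtain ⟨F, hF⟩ := Finite.exists_infinite_fiber fun (g : Γ) (y : A) =>
    (⟨cantorShift g y, hA g y.2⟩ : A)
  rw [infinite_coe_iff] at hF
  obtain ⟨g₀, hg₀⟩ := hF.nonempty
  refine (hF.image (mul_right_injective g₀⁻¹).injOn).mono ?_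
  rintro _ ⟨g, hg, rfl⟩
  refine (MPAut.mk_eq_mk_iff (T := 1)).2 ?_
  rw [map_shiftTrans]
  refine measure_mono_null (fun y hy => ?_) hAν
  intro hyA
  apply hy
  change cantorShift (g₀⁻¹ * g) y = y
  have h1 : cantorShift g y = cantorShift g₀ y :=
    congrArg Subtype.val (congrFun ((show _ = F from hg).trans (show _ = F from hg₀).symm) ⟨y, hyA⟩)
  rw [cantorShift_mul, h1, ← cantorShift_mul, inv_mul_cancel, cantorShift_one]

lemma FiniteSupportDense.dense_isRigid {Γ : Type u} [Group Γ] [Countable Γ] [Infinite Γ]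
    (hΓ : FiniteSupportDense Γ) {X : Type*} [MeasurableSpace X] [StandardBorelSpace X]
    (μ : Measure X) [IsProbabilityMeasure μ] [NullSingletonClass μ] :
    Dense {a : ActionSpace Γ μ | a.IsRigid} := by
  intro a
  refine ActionSpace.mem_closure_isRigid_of_forall_exists_infinite_ker.{u} fun M P hP K d hd => ?_
  obtain ⟨x₀⟩ := nonempty_of_isProbabilityMeasure μ
  have : NeZero M := ⟨fun h => (h ▸ P x₀).elim0⟩
  obtain ⟨j, q, hq, hqj⟩ := exists_locallyConstant_cantorSet M
  -- The factor of `a` that is generated by the label `P`, as an invariant measure on `𝒞^Γ`.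
  let Θ : X → Γ → cantorSet := fun x f => j (P (a.act f⁻¹ x))
  have hΘ : Measurable Θ := measurable_pi_lambda _ fun f =>
    (measurable_of_countable j).comp (hP.comp (a.measurePreserving_act _).measurable)
  have hν₀ : IsProbabilityMeasure (μ.map Θ) := Measure.isProbabilityMeasure_map hΘ.aemeasurable
  have hΘinv (g : Γ) : (μ.map Θ).map (cantorShift g) = μ.map Θ := by
    rw [Measure.map_map (measurable_cantorShift g) hΘ]
    have h1 : cantorShift g ∘ Θ =ᵐ[μ] Θ ∘ a.act g := by
      filter_upwards [ae_all_iff.2 fun f : Γ => a.act_mul f⁻¹ g] with x hx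
      funext f
      change j (P (a.act (g⁻¹ * f)⁻¹ x)) = j (P (a.act f⁻¹ (a.act g x)))
      rw [mul_inv_rev, inv_inv, hx f]
      rfl
    rw [Measure.map_congr h1, ← Measure.map_map hΘ (a.measurePreserving_act g).measurable,
      (a.measurePreserving_act g).map_eq]
  let ν₀ : InvProb Γ := ⟨⟨μ.map Θ, hν₀⟩, hΘinv⟩
  let E (w : K → Fin M) : Set (Γ → cantorSet) := {y | ∀ g : K, q (y (g : Γ)⁻¹) = w g}
  have hE (w : K → Fin M) : IsClopen (E w) := by
    have : E w = (fun (y : Γ → cantorSet) (g : K) => q (y (g : Γ)⁻¹)) ⁻¹' {w} := by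
      ext y
      exact funext_iff.symm
    rw [this]
    exact (isClopen_discrete _).preimage (by fun_prop)
  have hnear : ∀ᶠ ν : InvProb Γ in 𝓝 ν₀, ∀ w,
      |(μ.map Θ).real (E w) - (ν.1 : Measure (Γ → cantorSet)).real (E w)| < d := by
    rw [Filter.eventually_all]
    intro w
    have h1 := ProbabilityMeasure.tendsto_measure_of_isClopen_of_tendsto
      (continuous_subtype_val.tendsto ν₀) (hE w)
    have h2 := (Metric.tendsto_nhds.1 ((NNReal.continuous_coe.tendsto _).comp h1)) d hd
    filter_upwards [h2] with ν hν
    rw [dist_comm, Real.dist_eq] at hν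
    exact hν
  obtain ⟨ν, hν, S, hS, hSν⟩ := (mem_closure_iff_nhds.1 (hΓ ν₀)) _ hnear
  have : StandardBorelSpace cantorSet := isClosed_cantorSet.measurableSet.standardBorel
  let b : ActionSpace Γ (ν.1 : Measure (Γ → cantorSet)) :=
    (QuotientGroup.mk' _).comp (shiftTrans _ ν.2)
  have hb (g : Γ) : b.act g =ᵐ[(ν.1 : Measure (Γ → cantorSet))] cantorShift g := MPAut.rep_mk _
  refine ⟨Γ → cantorSet, inferInstance, inferInstance, ν.1, inferInstance, b, fun y => q (y 1),
    infinite_setOf_shift_eq_one _ ν.2 hS hSν, hq.measurable.comp (measurable_pi_apply 1),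
    fun w => ?_⟩
  have h1 : μ.real {x | ∀ g : K, P (a.act g x) = w g} = (μ.map Θ).real (E w) := by
    rw [Measure.real, Measure.real, Measure.map_apply hΘ (hE w).isClosed.measurableSet]
    congr 2
    ext x
    simp [E, Θ, hqj]
  have h2 : (ν.1 : Measure (Γ → cantorSet)).real {y | ∀ g : K, q (b.act g y 1) = w g} =
      (ν.1 : Measure (Γ → cantorSet)).real (E w) := by
    refine measureReal_congr ?_
    filter_upwards [ae_all_iff.2 fun g : K => hb g] with y hy
    refine propext (forall_congr' fun g => ?_)
    rw [hy g]
    simp [cantorShift]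
  rw [h1, h2]
  exact (hν w).le

end FiniteSupport

/-! ### Groups for which the class of `p_Γ × ι` is dense -/

section Profinite

/-- Translations of the first factor of `G × Z` are continuous in measure. The product need not be a
Borel space when `G` has no countable basis, so the result for Borel sets of `G` is extended from
rectangles. -/
lemma tendsto_measure_translate_symmDiff {G Z : Type*} [Group G] [TopologicalSpace G]
    [IsTopologicalGroup G] [MeasurableSpace G] [BorelSpace G]
    (m : Measure G) [IsProbabilityMeasure m] [m.IsMulLeftInvariant] [m.Regular]
    [MeasurableSpace Z] (ρ : Measure Z) [IsProbabilityMeasure ρ] {B : Set (G × Z)}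
    (hB : MeasurableSet B) :
    Filter.Tendsto (fun k : G => m.prod ρ (((fun p : G × Z => (k * p.1, p.2)) ⁻¹' B) ∆ B)) (𝓝 1)
      (𝓝 0) := by
  have htr (k : G) : MeasurePreserving (fun p : G × Z => (k * p.1, p.2)) (m.prod ρ) (m.prod ρ) :=
    (measurePreserving_mul_left m k).prod (MeasurePreserving.id ρ)
  induction B, hB using MeasurableSpace.induction_on_inter generateFrom_prod.symm isPiSystem_prod with
  | empty => simp
  | basic B hB =>
    obtain ⟨S, hS, C, hC, rfl⟩ := hB
    let f : C(G, C(G, G)) := ContinuousMap.curry ⟨fun p : G × G => p.1 * p.2, continuous_mul⟩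
    have hf : Filter.Tendsto f (𝓝 1) (𝓝 (ContinuousMap.id G)) :=
      f.continuous.tendsto' 1 _ (ContinuousMap.ext fun x => one_mul x)
    have h1 := tendsto_measure_symmDiff_preimage_nhds_zero (μ := m) (ν := m) (s := S) hf
      (.of_forall fun k => measurePreserving_mul_left m k) (MeasurePreserving.id m)
      (MeasurableSet.nullMeasurableSet hS) (measure_ne_top _ _)
    refine tendsto_of_tendsto_of_tendsto_of_le_of_le tendsto_const_nhds h1 (fun _ => zero_le)
      fun k => ?_
    calc m.prod ρ (((fun p : G × Z => (k * p.1, p.2)) ⁻¹' S ×ˢ C) ∆ (S ×ˢ C))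
        ≤ m.prod ρ ((((fun x => k * x) ⁻¹' S) ∆ S) ×ˢ univ) := by
          refine measure_mono ?_
          rintro p (⟨⟨h1, h2⟩, h3⟩ | ⟨⟨h1, h2⟩, h3⟩)
          · exact ⟨Or.inl ⟨h1, fun h => h3 ⟨h, h2⟩⟩, trivial⟩
          · exact ⟨Or.inr ⟨h1, fun h => h3 ⟨h, h2⟩⟩, trivial⟩
      _ = m (((fun x => k * x) ⁻¹' S) ∆ S) := by simp [Measure.prod_prod]
  | compl B _ ih =>
    refine ih.congr fun k => ?_
    rw [preimage_compl, compl_symmDiff_compl]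
  | iUnion f hdisj hf ih =>
    rw [ENNReal.tendsto_nhds_zero]
    intro ε hε
    have hε3 : 0 < ε / 3 := ENNReal.div_pos hε.ne' (by norm_num)
    have htail := tendsto_measure_biUnion_Ici_zero_of_pairwise_disjoint (μ := m.prod ρ)
      (fun i => (hf i).nullMeasurableSet) hdisj
    obtain ⟨n, hn⟩ := ((ENNReal.tendsto_nhds_zero.1 htail) _ hε3).exists
    have hsum := tendsto_finsetSum (Finset.range n) fun i _ => ih i
    rw [Finset.sum_const_zero] at hsum
    filter_upwards [(ENNReal.tendsto_nhds_zero.1 hsum) _ hε3] with k hk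
    set τ : G × Z → G × Z := fun p => (k * p.1, p.2) with hτ
    set R : Set (G × Z) := ⋃ i ∈ Ici n, f i with hR
    have hRm : MeasurableSet R := .biUnion (to_countable _) fun i _ => hf i
    have hsub : ((τ ⁻¹' ⋃ i, f i) ∆ ⋃ i, f i) ⊆
        (⋃ i ∈ Finset.range n, ((τ ⁻¹' f i) ∆ f i)) ∪ (τ ⁻¹' R ∪ R) := by
      intro p hp
      by_contra hpn
      simp only [mem_union, mem_iUnion, Finset.mem_range, not_or, not_exists, mem_preimage, hR,
        mem_Ici] at hpn
      obtain ⟨h1, h2, h3⟩ := hpn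
      have key (i : ℕ) : τ p ∈ f i ↔ p ∈ f i := by
        by_cases hi : i < n
        · have := h1 i hi
          simp only [mem_symmDiff, mem_preimage] at this
          tauto
        · exact iff_of_false (h2 i (not_lt.1 hi)) (h3 i (not_lt.1 hi))
      simp only [mem_symmDiff, mem_preimage, mem_iUnion, key] at hp
      tauto
    have hRε : m.prod ρ R ≤ ε / 3 := hn
    calc m.prod ρ ((τ ⁻¹' ⋃ i, f i) ∆ ⋃ i, f i) ≤ _ := measure_mono hsub
      _ ≤ m.prod ρ (⋃ i ∈ Finset.range n, ((τ ⁻¹' f i) ∆ f i)) +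
          (m.prod ρ (τ ⁻¹' R) + m.prod ρ R) :=
        (measure_union_le _ _).trans (by gcongr; exact measure_union_le _ _)
      _ ≤ ε / 3 + (ε / 3 + ε / 3) := by
        rw [(htr k).measure_preimage hRm.nullMeasurableSet]
        gcongr
        exact (measure_biUnion_finset_le _ _).trans hk
      _ = ε := by rw [← add_assoc, ENNReal.add_thirds]

/-- An infinite group returns infinitely often to every neighbourhood of the identity of a compact
group, since its image accumulates at some point. -/
lemma infinite_setOf_map_mem_nhds_one {Γ G : Type*} [Group Γ] [Infinite Γ] [Group G]
    [TopologicalSpace G] [IsTopologicalGroup G] [CompactSpace G] (η : Γ →* G) {V : Set G}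
    (hV : V ∈ 𝓝 (1 : G)) : {g | η g ∈ V}.Infinite := by
  obtain ⟨x, hx⟩ := exists_clusterPt_of_compactSpace (Filter.map η Filter.cofinite)
  have hc : Filter.Tendsto (fun p : G × G => p.1⁻¹ * p.2) (𝓝 (x, x)) (𝓝 1) :=
    (continuous_fst.inv.mul continuous_snd).tendsto' _ _ (inv_mul_cancel x)
  obtain ⟨N, hN, hNV⟩ : ∃ N ∈ 𝓝 x, ∀ y ∈ N, ∀ z ∈ N, y⁻¹ * z ∈ V := by
    have h := hc hV
    rw [nhds_prod_eq, Filter.mem_map, Filter.mem_prod_self_iff] at h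
    obtain ⟨N, hN, hsub⟩ := h
    exact ⟨N, hN, fun y hy z hz => hsub (mk_mem_prod hy hz)⟩
  have hinf : {g | η g ∈ N}.Infinite :=
    Filter.frequently_cofinite_iff_infinite.1 (Filter.frequently_map.1
      (hx.frequently hN : _))
  obtain ⟨g₀, hg₀⟩ := hinf.nonempty
  refine (hinf.image (mul_right_injective g₀⁻¹).injOn).mono ?_
  rintro _ ⟨g, hg, rfl⟩
  change η (g₀⁻¹ * g) ∈ V
  rw [map_mul, map_inv]
  exact hNV _ hg₀ _ hg

instance (Γ : Type u) [Group Γ] : IsProbabilityMeasure (profiniteHaar Γ) :=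
  ⟨Measure.haarMeasure_self (K₀ := ⊤)⟩

instance (Γ : Type u) [Group Γ] : (profiniteHaar Γ).IsMulLeftInvariant :=
  inferInstanceAs (Measure.haarMeasure ⊤).IsMulLeftInvariant

instance (Γ : Type u) [Group Γ] : (profiniteHaar Γ).Regular :=
  inferInstanceAs (Measure.haarMeasure ⊤).Regular

/-- Actions conjugate to `p_Γ × ι` are rigid: the action factors through translations of a compact
group, which are continuous in measure. -/
lemma IsMeasureConjugate.isRigid {Γ : Type u} [Group Γ] [Infinite Γ] {X : Type*}
    [MeasurableSpace X] {μ : Measure X} {a : ActionSpace Γ μ}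
    (h : IsMeasureConjugate a ((profiniteHaar Γ).prod (volume : Measure unitInterval))
      (profiniteTimesTrivial Γ)) : a.IsRigid := by
  obtain ⟨φ, ψ, hφ, hψ, hψφ, -, hT⟩ := h
  let η : Γ →* ProfiniteCompl Γ := (ProfiniteGrp.ProfiniteCompletion.eta (GrpCat.of Γ)).hom
  have htend : Filter.Tendsto a.hom (Filter.comap η (𝓝 1)) (𝓝 1) := by
    rw [MPAut.nhds_one_eq, Filter.tendsto_iInf]
    intro A
    rw [Filter.tendsto_comap_iff]
    set B := ψ ⁻¹' (A : Set X) with hB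
    have hBm : MeasurableSet B := hψ.measurable A.2
    refine ((tendsto_measure_translate_symmDiff (profiniteHaar Γ)
      (volume : Measure unitInterval) hBm).comp Filter.tendsto_comap).congr fun g => ?_
    have hTm : Measurable (profiniteTimesTrivial Γ g) :=
      (measurable_fst.const_mul _).prodMk measurable_snd
    have hBA : φ ⁻¹' B =ᵐ[μ] (A : Set X) := hψφ.preimage (A : Set X)
    have h1 : a.act g ⁻¹' (A : Set X) =ᵐ[μ] φ ⁻¹' (profiniteTimesTrivial Γ g ⁻¹' B) :=
      ((a.measurePreserving_act g).quasiMeasurePreserving.preimage_ae_eq hBA).symm.trans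
        ((hT g).preimage B)
    have hm : MeasurableSet ((profiniteTimesTrivial Γ g ⁻¹' B) ∆ B) := (hTm hBm).symmDiff hBm
    change (profiniteHaar Γ).prod volume ((profiniteTimesTrivial Γ g ⁻¹' B) ∆ B) =
      μ ((a.act g ⁻¹' (A : Set X)) ∆ A)
    rw [measure_congr (h1.symmDiff hBA.symm), ← preimage_symmDiff,
      hφ.measure_preimage hm.nullMeasurableSet]
  intro U hU
  obtain ⟨V, hV, hVU⟩ := Filter.mem_comap.1 (htend hU)
  exact (infinite_setOf_map_mem_nhds_one η hV).mono hVU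

lemma ProfiniteClassDense.dense_isRigid {Γ : Type u} [Group Γ] [Infinite Γ]
    (hΓ : ProfiniteClassDense Γ) {X : Type*} [MeasurableSpace X] [StandardBorelSpace X]
    (μ : Measure X) [IsProbabilityMeasure μ] [NullSingletonClass μ] :
    Dense {a : ActionSpace Γ μ | a.IsRigid} := by
  obtain ⟨e, he, -⟩ := exists_measurableEquiv_unitInterval μ (P := fun _ => 0) measurable_const
  refine ((ActionSpace.conj_surjective e he).denseRange.dense_image
    (ActionSpace.continuous_conj e he) hΓ).mono ?_
  rintro _ ⟨b, hb, rfl⟩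
  exact ActionSpace.IsRigid.conj (IsMeasureConjugate.isRigid hb) e he

end Profinite

/-! ### Almost equivariant maps from finite actions of an amenable group -/

section AlmostEquivariant

open Finset in
/-- In a uniformly random order on `C`, the first element of a finite set is uniformly distributed.
The set is parametrised by an injection `p`, and `m σ` is the index of the element that `σ` makes
the first. -/
lemma card_filter_argmin_mem_mul {α C : Type*} [DecidableEq α] [Fintype C] [DecidableEq C]
    {n : ℕ} (r : C ≃ Fin n) {F T : Finset α} (hT : T ⊆ F) {p : α → C} (hp : InjOn p F)
    {m : Equiv.Perm C → α} (hmF : ∀ σ, m σ ∈ F)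
    (hm : ∀ σ : Equiv.Perm C, ∀ f ∈ F, r (σ (p (m σ))) ≤ r (σ (p f))) :
    #{σ | m σ ∈ T} * #F = #T * Fintype.card (Equiv.Perm C) := by
  have huniq (σ : Equiv.Perm C) {f : α} (hf : f ∈ F)
      (hmin : ∀ f' ∈ F, r (σ (p f)) ≤ r (σ (p f'))) : m σ = f :=
    hp (hmF σ) hf (σ.injective (r.injective (le_antisymm (hm σ f hf) (hmin _ (hmF σ)))))
  have hle {f f' : α} (hf : f ∈ F) (hf' : f' ∈ F) : #{σ | m σ = f} ≤ #{σ | m σ = f'} := by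
    refine Finset.card_le_card_of_injOn (fun σ => σ * Equiv.swap (p f) (p f')) ?_
      (fun σ _ τ _ h => mul_right_cancel h)
    intro σ hσ
    have hσ' : m σ = f := by simpa using hσ
    have hmin : ∀ f'' ∈ F, r (σ (p f)) ≤ r (σ (p f'')) := hσ' ▸ hm σ
    simp only [coe_filter, Finset.mem_univ, true_and, mem_ofPred_eq]
    refine huniq _ hf' fun f'' hf'' => ?_
    simp only [Equiv.Perm.mul_apply, Equiv.swap_apply_right]
    by_cases h1 : p f'' = p f
    · rw [h1, Equiv.swap_apply_left]
      exact hmin f' hf'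
    by_cases h2 : p f'' = p f'
    · rw [h2, Equiv.swap_apply_right]
    · rw [Equiv.swap_apply_of_ne_of_ne h1 h2]
      exact hmin f'' hf''
  have hF0 : F.Nonempty := ⟨_, hmF 1⟩
  obtain ⟨f₀, hf₀⟩ := hF0
  have hN (f : α) (hf : f ∈ F) : #{σ | m σ = f} = #{σ | m σ = f₀} :=
    le_antisymm (hle hf hf₀) (hle hf₀ hf)
  have hcount (S : Finset α) (hS : S ⊆ F) : #{σ | m σ ∈ S} = #S * #{σ | m σ = f₀} := by
    rw [card_eq_sum_card_fiberwise (f := m) (t := S) fun σ hσ => by simpa using hσ,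
      sum_const_nat fun f hf => ?_]
    rw [← hN f (hS hf), filter_filter]
    congr 1
    ext σ
    simp only [Finset.mem_filter, Finset.mem_univ, true_and, and_iff_right_iff_imp]
    rintro rfl
    exact hf
  have huniv : #{σ | m σ ∈ F} = Fintype.card (Equiv.Perm C) := by
    rw [filter_true_of_mem fun σ _ => hmF σ, card_univ]
  rw [← huniv, hcount T hT, hcount F subset_rfl]
  ring

open Finset in
/-- A Følner set `F` that acts injectively on the points of a finite `H`-set `C` gives an almost
equivariant map `θ : C → H`. For an order on `C`, let `θ y` be the element `f` of `F` for which
`f⁻¹ y` comes first. The map is equivariant at `y` and `k` if `k θ(y)` and `k⁻¹ θ(k y)` are in `F`.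
For a random order `θ y` is uniformly distributed in `F`, so this rarely fails. -/
lemma exists_almost_equivariant_of_folner {H C : Type*} [Group H] [DecidableEq H] [Fintype C]
    [DecidableEq C] [MulAction H C] {F : Finset H} (hF : F.Nonempty)
    (hinj : ∀ f ∈ F, ∀ f' ∈ F, ∀ c : C, f • c = f' • c → f = f') (K : Finset H) {ε : ℝ}
    (hε : ∀ k ∈ K, (#{f ∈ F | k * f ∉ F} : ℝ) ≤ ε * #F ∧
      (#{f ∈ F | k⁻¹ * f ∉ F} : ℝ) ≤ ε * #F) :
    ∃ θ : C → H, (#{c : C | ∃ k ∈ K, θ (k • c) ≠ k * θ c} : ℝ) ≤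
      2 * #K * ε * Fintype.card C := by
  let r : C ≃ Fin (Fintype.card C) := Fintype.equivFin C
  have hex (σ : Equiv.Perm C) (y : C) : ∃ f ∈ F, ∀ f' ∈ F, r (σ (f⁻¹ • y)) ≤ r (σ (f'⁻¹ • y)) :=
    F.exists_min_image _ hF
  choose θ hθF hθ using hex
  have hpinj (y : C) : InjOn (fun f : H => f⁻¹ • y) F := fun f hf f' hf' h =>
    hinj f hf f' hf' (f⁻¹ • y) (by
      conv_rhs => rw [show f⁻¹ • y = f'⁻¹ • y from h]
      rw [smul_inv_smul, smul_inv_smul])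
  have hF0 : (0 : ℝ) < #F := by exact_mod_cast hF.card_pos
  -- The average number of points at which a given translation leads out of `F`.
  have havg (k : H) (hk : (#{f ∈ F | k * f ∉ F} : ℝ) ≤ ε * #F) :
      ∑ σ : Equiv.Perm C, (#{y | k * θ σ y ∉ F} : ℝ) ≤
        ε * Fintype.card C * Fintype.card (Equiv.Perm C) := by
    have hswap : ∑ σ : Equiv.Perm C, (#{y | k * θ σ y ∉ F} : ℝ) =
        ∑ y : C, (#{σ | θ σ y ∈ ({f ∈ F | k * f ∉ F} : Finset H)} : ℝ) := by
      have := sum_card_bipartiteAbove_eq_sum_card_bipartiteBelow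
        (s := (univ : Finset (Equiv.Perm C))) (t := (univ : Finset C)) fun σ y => k * θ σ y ∉ F
      simp only [bipartiteAbove, bipartiteBelow] at this
      rw [← Nat.cast_sum, this, Nat.cast_sum]
      refine sum_congr rfl fun y _ => ?_
      congr 2
      ext σ
      simp [hθF]
    rw [hswap]
    have hy (y : C) : (#{σ | θ σ y ∈ ({f ∈ F | k * f ∉ F} : Finset H)} : ℝ) ≤
        ε * Fintype.card (Equiv.Perm C) := by
      have h1 := card_filter_argmin_mem_mul r (filter_subset (fun f => k * f ∉ F) F) (hpinj y)
        (m := fun σ => θ σ y) (fun σ => hθF σ y) fun σ => hθ σ y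
      have h2 : (#{σ | θ σ y ∈ ({f ∈ F | k * f ∉ F} : Finset H)} : ℝ) * #F ≤
          (ε * Fintype.card (Equiv.Perm C)) * #F := by
        have h3 : (#{σ | θ σ y ∈ ({f ∈ F | k * f ∉ F} : Finset H)} : ℝ) * #F =
            #{f ∈ F | k * f ∉ F} * Fintype.card (Equiv.Perm C) := by exact_mod_cast h1
        rw [h3]
        calc _ ≤ ε * #F * (Fintype.card (Equiv.Perm C) : ℝ) := by gcongr
          _ = _ := by ring
      exact le_of_mul_le_mul_right h2 hF0
    refine (sum_le_sum fun y _ => hy y).trans (le_of_eq ?_)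
    simp
    ring
  have htotal : ∑ σ : Equiv.Perm C, ∑ k ∈ K,
      ((#{y | k * θ σ y ∉ F} : ℝ) + #{y | k⁻¹ * θ σ y ∉ F}) ≤
      ∑ σ : Equiv.Perm C, 2 * #K * ε * Fintype.card C := by
    rw [sum_comm]
    simp only [sum_add_distrib]
    calc _ ≤ ∑ k ∈ K, (ε * Fintype.card C * Fintype.card (Equiv.Perm C)) +
          ∑ k ∈ K, (ε * Fintype.card C * Fintype.card (Equiv.Perm C)) :=
          add_le_add (sum_le_sum fun k hk => havg k (hε k hk).1)
            (sum_le_sum fun k hk => havg k⁻¹ (hε k hk).2)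
      _ = _ := by
          simp only [sum_const, nsmul_eq_mul, card_univ]
          ring
  obtain ⟨σ, -, hσ⟩ := exists_le_of_sum_le univ_nonempty htotal
  refine ⟨θ σ, le_trans ?_ hσ⟩
  have hequi {k : H} {y : C} (h1 : k * θ σ y ∈ F) (h2 : k⁻¹ * θ σ (k • y) ∈ F) :
      θ σ (k • y) = k * θ σ y := by
    have h3 := hθ σ (k • y) _ h1
    have h4 := hθ σ y _ h2
    simp only [mul_inv_rev, mul_smul, inv_smul_smul, inv_inv] at h3 h4
    have h5 : (θ σ (k • y))⁻¹ • k • y = (θ σ y)⁻¹ • y :=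
      σ.injective (r.injective (le_antisymm h3 h4))
    refine hinj _ (hθF _ _) _ h1 ((θ σ y)⁻¹ • y) ?_
    rw [← h5, smul_inv_smul, h5, mul_smul, smul_inv_smul]
  have hsub : ({c : C | ∃ k ∈ K, θ σ (k • c) ≠ k * θ σ c} : Finset C) ⊆
      K.biUnion fun k => ({y | k * θ σ y ∉ F} : Finset C) ∪
        ({y | k⁻¹ * θ σ (k • y) ∉ F} : Finset C) := by
    intro y hy
    simp only [Finset.mem_filter, Finset.mem_univ, true_and] at hy
    obtain ⟨k, hk, hne⟩ := hy
    simp only [Finset.mem_biUnion, Finset.mem_union, Finset.mem_filter, Finset.mem_univ, true_and]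
    refine ⟨k, hk, ?_⟩
    by_contra! h
    exact hne (hequi h.1 h.2)
  have hcard (k : H) : #{y : C | k⁻¹ * θ σ (k • y) ∉ F} ≤ #{y : C | k⁻¹ * θ σ y ∉ F} :=
    Finset.card_le_card_of_injOn (fun y => k • y) (fun y hy => by simpa using hy)
      (MulAction.injective k).injOn
  have hfin : #{c : C | ∃ k ∈ K, θ σ (k • c) ≠ k * θ σ c} ≤
      ∑ k ∈ K, (#{y | k * θ σ y ∉ F} + #{y | k⁻¹ * θ σ y ∉ F}) :=
    (Finset.card_le_card hsub).trans (card_biUnion_le.trans (sum_le_sum fun k _ =>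
      (Finset.card_union_le _ _).trans (Nat.add_le_add_left (hcard k) _)))
  exact_mod_cast hfin

/-- The kernel of an action of an infinite group on a finite set is infinite. -/
lemma infinite_setOf_forall_smul_eq {H C : Type*} [Group H] [Infinite H] [Finite C]
    [MulAction H C] : {h : H | ∀ c : C, h • c = c}.Infinite := by
  obtain ⟨F, hF⟩ := Finite.exists_infinite_fiber fun (h : H) (c : C) => h • c
  rw [infinite_coe_iff] at hF
  obtain ⟨g₀, hg₀⟩ := hF.nonempty
  refine (hF.image (mul_right_injective g₀⁻¹).injOn).mono ?_
  rintro _ ⟨g, hg, rfl⟩ c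
  have h1 : g • c = g₀ • c :=
    congrFun ((show _ = F from hg).trans (show _ = F from hg₀).symm) c
  change (g₀⁻¹ * g) • c = c
  rw [mul_smul, h1, inv_smul_smul]

/-- An amenable residually finite group has finite actions `C` with almost equivariant maps
`C → H`. -/
lemma IsAmenableGroup.exists_almost_equivariant {H : Type u} [Group H] (hA : IsAmenableGroup H)
    [Group.ResiduallyFinite H] (K : Finset H) {ε : ℝ} (hε : 0 < ε) :
    ∃ (C : Type u) (_ : Finite C) (_ : Nonempty C) (_ : MulAction H C) (θ : C → H),
      ({c : C | ∃ k ∈ K, θ (k • c) ≠ k * θ c}.ncard : ℝ) ≤ ε * Nat.card C := by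
  classical
  set δ : ℝ := ε / (2 * K.card + 1) with hδ
  have hδ0 : 0 < δ := by positivity
  obtain ⟨F, hF, hFK⟩ := hA (K ∪ K.image fun k => k⁻¹) δ hδ0
  have hFcard {k : H} (hk : k ∈ K ∪ K.image fun k => k⁻¹) :
      (({f ∈ F | k * f ∉ F} : Finset H).card : ℝ) ≤ δ * F.card := by
    refine le_trans ?_ (hFK k hk)
    rw [← Set.ncard_coe_finset]
    refine Nat.cast_le.2 (Set.ncard_le_ncard_of_injOn (fun x => k * x) (fun f hf => ?_)
      (mul_right_injective k).injOn
      (((F.finite_toSet.image _).union F.finite_toSet).subset symmDiff_subset_union))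
    simp only [Finset.coe_filter, mem_ofPred_eq] at hf
    exact Or.inl ⟨⟨f, hf.1, rfl⟩, hf.2⟩
  have hres (x : H) : ∃ N : FiniteIndexNormalSubgroup H, x ∈ N → x = 1 := by
    by_cases hx : x = 1
    · exact ⟨{ toSubgroup := ⊤ }, fun _ => hx⟩
    · by_contra! h
      exact hx (Group.residuallyFinite_iff_forall_finiteIndexNormalSubgroup.1 ‹_› x
        fun N => (h N).1)
  choose N hN using hres
  -- The finite quotients that separate the points of `F`, with the diagonal action.
  let C : Type u := (p : F × F) → H ⧸ (N ((p.1 : H)⁻¹ * p.2)).toSubgroup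
  have hCfin : Finite C := inferInstance
  have hinj : ∀ f ∈ F, ∀ f' ∈ F, ∀ c : C, f • c = f' • c → f = f' := by
    intro f hf f' hf' c h
    have h1 := congrFun h (⟨f, hf⟩, ⟨f', hf'⟩)
    obtain ⟨x, hx⟩ := QuotientGroup.mk_surjective (c (⟨f, hf⟩, ⟨f', hf'⟩))
    change f • c (⟨f, hf⟩, ⟨f', hf'⟩) = f' • c (⟨f, hf⟩, ⟨f', hf'⟩) at h1
    rw [← hx] at h1
    have h2 : (f * x)⁻¹ * (f' * x) ∈ (N (f⁻¹ * f')).toSubgroup := QuotientGroup.eq.1 h1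
    have h3 := (N (f⁻¹ * f')).isNormal'.conj_mem _ h2 x
    have h4 : x * ((f * x)⁻¹ * (f' * x)) * x⁻¹ = f⁻¹ * f' := by group
    rw [h4] at h3
    exact inv_mul_eq_one.1 (hN _ h3)
  have := Fintype.ofFinite C
  obtain ⟨θ, hθ⟩ := exists_almost_equivariant_of_folner hF hinj K fun k hk =>
    ⟨hFcard (Finset.mem_union_left _ hk),
      hFcard (Finset.mem_union_right _ (Finset.mem_image_of_mem _ hk))⟩
  refine ⟨C, hCfin, inferInstance, inferInstance, θ, ?_⟩
  have h1 : {c : C | ∃ k ∈ K, θ (k • c) ≠ k * θ c} =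
      (({c : C | ∃ k ∈ K, θ (k • c) ≠ k * θ c} : Finset C) : Set C) := by simp
  rw [h1, Set.ncard_coe_finset, Nat.card_eq_fintype_card]
  refine hθ.trans ?_
  gcongr
  rw [hδ, ← mul_div_assoc, div_le_iff₀ (by positivity)]
  nlinarith

end AlmostEquivariant

/-! ### Products with an amenable residually finite group -/

section Product

variable {X : Type*} [MeasurableSpace X] {μ : Measure X}

/-- The normalized counting measure on a finite type. -/
noncomputable def uniformMeasure (C : Type*) [MeasurableSpace C] : Measure C :=
  (Nat.card C : ℝ≥0∞)⁻¹ • Measure.count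

instance (C : Type*) [MeasurableSpace C] [Finite C] [Nonempty C] :
    IsProbabilityMeasure (uniformMeasure C) := ⟨by
  rw [uniformMeasure, Measure.smul_apply, Measure.count_univ, smul_eq_mul,
    ENat.card_eq_coe_natCard, ENat.toENNReal_coe]
  exact ENNReal.inv_mul_cancel (by simp [Nat.card_pos.ne']) (by simp)⟩

lemma measurePreserving_uniformMeasure {C : Type*} [MeasurableSpace C] [DiscreteMeasurableSpace C]
    [Countable C] (σ : Equiv.Perm C) :
    MeasurePreserving σ (uniformMeasure C) (uniformMeasure C) := by
  refine ⟨measurable_of_countable σ, Measure.ext_of_singleton fun c => ?_⟩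
  rw [Measure.map_apply (measurable_of_countable σ) (measurableSet_singleton c)]
  have : σ ⁻¹' {c} = {σ.symm c} := by
    ext x
    exact (Equiv.eq_symm_apply σ).symm
  rw [this]
  simp [uniformMeasure]

/-- The permutations of a finite type as transformations of the second factor of a product. -/
noncomputable def permTrans (μ : Measure X) [SFinite μ] (C : Type*) [MeasurableSpace C]
    [DiscreteMeasurableSpace C] [Finite C] [Nonempty C] :
    Equiv.Perm C →* MPTrans (μ.prod (uniformMeasure C)) where
  toFun σ := ⟨Equiv.prodCongr (Equiv.refl X) σ,
    (MeasurePreserving.id μ).prod (measurePreserving_uniformMeasure σ),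
    (MeasurePreserving.id μ).prod (measurePreserving_uniformMeasure σ.symm)⟩
  map_one' := rfl
  map_mul' _ _ := rfl

lemma commute_prodId_permTrans [SFinite μ] {C : Type*} [MeasurableSpace C]
    [DiscreteMeasurableSpace C] [Finite C] [Nonempty C] (T : MPAut μ) (σ : Equiv.Perm C) :
    Commute (MPAut.prodId (uniformMeasure C) T)
      (permTrans μ C σ : MPAut (μ.prod (uniformMeasure C))) := by
  rw [← MPAut.mk_out T]
  change ((MPTrans.prodId (uniformMeasure C) (Quotient.out T) * permTrans μ C σ :
    MPTrans (μ.prod (uniformMeasure C))) : MPAut (μ.prod (uniformMeasure C))) =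
    (permTrans μ C σ * MPTrans.prodId (uniformMeasure C) (Quotient.out T) :
      MPTrans (μ.prod (uniformMeasure C)))
  congr 1

/-- A set in the product with a finite uniform space has almost the measure `m` if most of its
sections have measure `m`. -/
lemma abs_sub_measureReal_prod_uniformMeasure_le [IsProbabilityMeasure μ] {C : Type*}
    [MeasurableSpace C] [DiscreteMeasurableSpace C] [Finite C] [Nonempty C] {E : Set (X × C)}
    (hE : MeasurableSet E) {A : Set X} {D : Set C}
    (h : ∀ c ∉ D, μ.real {x | (x, c) ∈ E} = μ.real A) :
    |μ.real A - (μ.prod (uniformMeasure C)).real E| ≤ D.ncard / Nat.card C := by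
  classical
  have := Fintype.ofFinite C
  have hN : (0 : ℝ) < Nat.card C := by exact_mod_cast Nat.card_pos
  have h1 : (μ.prod (uniformMeasure C)).real E =
      (Nat.card C : ℝ)⁻¹ * ∑ c, μ.real {x | (x, c) ∈ E} := by
    rw [Measure.real, Measure.prod_apply_symm hE, uniformMeasure, lintegral_smul_measure,
      lintegral_count, tsum_fintype, smul_eq_mul, ENNReal.toReal_mul, ENNReal.toReal_inv,
      ENNReal.toReal_natCast, ENNReal.toReal_sum fun c _ => measure_ne_top _ _]
    rfl
  have h2 : μ.real A - (μ.prod (uniformMeasure C)).real E =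
      (Nat.card C : ℝ)⁻¹ * ∑ c, (μ.real A - μ.real {x | (x, c) ∈ E}) := by
    rw [h1, Finset.sum_sub_distrib, Finset.sum_const, Finset.card_univ, nsmul_eq_mul,
      ← Nat.card_eq_fintype_card, mul_sub, inv_mul_cancel_left₀ hN.ne']
  have h3 : ∑ c, |μ.real A - μ.real {x | (x, c) ∈ E}| ≤ D.ncard := by
    calc _ ≤ ∑ c, if c ∈ D then (1 : ℝ) else 0 := by
          refine Finset.sum_le_sum fun c _ => ?_
          split_ifs with hc
          · exact abs_sub_le_of_nonneg_of_le measureReal_nonneg measureReal_le_one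
              measureReal_nonneg measureReal_le_one
          · rw [h c hc, sub_self, abs_zero]
      _ = D.ncard := by
          rw [Finset.sum_boole, Set.ncard_eq_toFinset_card']
          congr 2
          ext c
          simp
  rw [h2, abs_mul, abs_of_pos (inv_pos.2 hN), inv_mul_eq_div]
  gcongr
  exact (Finset.abs_sum_le_sum_abs _ _).trans h3

/-- Rigid actions of `G × H` are dense: `H` can be made to act through a finite quotient, by
transferring its action on `X` to a finite `H`-set along an almost equivariant map. -/
lemma dense_isRigid_of_mulEquiv_prod {Γ : Type u} [Group Γ] {G H : Type u} [Group G] [Group H]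
    [Infinite H] (hA : IsAmenableGroup H) [Group.ResiduallyFinite H] (φ : Γ ≃* G × H)
    {X : Type v} [MeasurableSpace X] [StandardBorelSpace X] (μ : Measure X)
    [IsProbabilityMeasure μ] [NullSingletonClass μ] :
    Dense {a : ActionSpace Γ μ | a.IsRigid} := by
  classical
  intro a
  refine ActionSpace.mem_closure_isRigid_of_forall_exists_infinite_ker.{max u v}
    fun M P hP K d hd => ?_
  obtain ⟨C, _, _, _, θ, hθ⟩ := hA.exists_almost_equivariant (K.image fun g => (φ g).2) hd
  let mC : MeasurableSpace C := ⊤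
  have : DiscreteMeasurableSpace C := ⟨fun _ => trivial⟩
  let i₁ : Γ →* Γ := φ.symm.toMonoidHom.comp
    ((MonoidHom.inl G H).comp ((MonoidHom.fst G H).comp φ.toMonoidHom))
  let i₂ : H →* Γ := φ.symm.toMonoidHom.comp (MonoidHom.inr G H)
  -- `G` acts on `X` as before, and `H` acts on the finite set `C` instead.
  let β : Γ → MPAut (μ.prod (uniformMeasure C)) := fun g =>
    MPAut.prodId (uniformMeasure C) (a.hom (i₁ g)) *
      (permTrans μ C (MulAction.toPermHom H C (φ g).2) : MPTrans (μ.prod (uniformMeasure C)))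
  let b : ActionSpace Γ (μ.prod (uniformMeasure C)) := MonoidHom.mk' β fun g h => by
    simp only [β, map_mul, Prod.snd_mul, QuotientGroup.mk_mul]
    exact ((commute_prodId_permTrans _ _).symm.mul_mul_mul_comm _ _).symm
  have hb (g : Γ) : ∀ᵐ z ∂(μ.prod (uniformMeasure C)),
      b.act g z = (a.act (i₁ g) z.1, (φ g).2 • z.2) := by
    have h1 : (β g).rep =ᵐ[μ.prod (uniformMeasure C)] _ := MPAut.rep_mul _ _
    have h2 := MPAut.rep_mk (permTrans μ C (MulAction.toPermHom H C (φ g).2))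
    have h3 := (MPTrans.measurePreserving_map
      (permTrans μ C (MulAction.toPermHom H C (φ g).2))).quasiMeasurePreserving.ae
        (MPAut.rep_prodId (uniformMeasure C) (a.hom (i₁ g)))
    filter_upwards [h1, h2, h3] with z hz1 hz2 hz3
    change (β g).rep z = _
    rw [hz1, Function.comp_apply, hz2, hz3]
    rfl
  let Q : X × C → Fin M := fun z => P (a.act (i₂ (θ z.2)) z.1)
  have hQ : Measurable Q := measurable_from_prod_countable_left fun c =>
    hP.comp (a.measurePreserving_act (i₂ (θ c))).measurable
  have : StandardBorelSpace C := inferInstance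
  refine ⟨X × C, inferInstance, inferInstance, μ.prod (uniformMeasure C), inferInstance, b, Q,
    ?_, hQ, fun w => ?_⟩
  · refine (infinite_setOf_forall_smul_eq (H := H) (C := C)).image
      (f := i₂) (fun h _ h' _ hh => ?_) |>.mono ?_
    · simpa [i₂] using hh
    · rintro _ ⟨h, hh, rfl⟩
      change β (i₂ h) = 1
      have h1 : i₁ (i₂ h) = 1 := by simp [i₁, i₂]
      have h2 : (φ (i₂ h)).2 = h := by simp [i₂]
      have h3 : MulAction.toPermHom H C h = 1 := Equiv.ext fun c => hh c
      simp only [β, h1, h2, h3, map_one, QuotientGroup.mk_one, mul_one]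
  · let E : Set (X × C) := {z | ∀ g : K,
      P (a.act (i₂ (θ ((φ g).2 • z.2))) (a.act (i₁ g) z.1)) = w g}
    have hE : MeasurableSet E := by
      have : E = ⋂ g : K, (fun z : X × C =>
          P (a.act (i₂ (θ ((φ g).2 • z.2))) (a.act (i₁ g) z.1))) ⁻¹' {w g} := by
        ext z
        simp [E]
      rw [this]
      have hg (g : K) : Measurable fun z : X × C =>
          P (a.act (i₂ (θ ((φ g).2 • z.2))) (a.act (i₁ g) z.1)) :=
        measurable_from_prod_countable_left fun c =>
          hP.comp ((a.measurePreserving_act (i₂ (θ ((φ g).2 • c)))).measurable.comp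
            (a.measurePreserving_act (i₁ g)).measurable)
      exact .iInter fun g => hg g (measurableSet_singleton _)
    have hEQ : (μ.prod (uniformMeasure C)).real {z | ∀ g : K, Q (b.act g z) = w g} =
        (μ.prod (uniformMeasure C)).real E := by
      refine measureReal_congr ?_
      filter_upwards [ae_all_iff.2 fun g : K => hb g] with z hz
      refine propext (forall_congr' fun g => ?_)
      rw [hz g]
    rw [hEQ]
    refine (abs_sub_measureReal_prod_uniformMeasure_le hE
      (D := {c | ∃ k ∈ K.image fun g => (φ g).2, θ (k • c) ≠ k * θ c}) fun c hc => ?_).trans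
      ((div_le_iff₀ (by exact_mod_cast Nat.card_pos)).2 hθ)
    -- Over a point where `θ` is equivariant the label is `P` along the orbit of `θ c • x`.
    have hsec : {x | (x, c) ∈ E} =ᵐ[μ]
        a.act (i₂ (θ c)) ⁻¹' {x | ∀ g : K, P (a.act g x) = w g} := by
      filter_upwards [ae_all_iff.2 fun g : K => a.act_mul (i₂ (θ ((φ g).2 • c))) (i₁ g),
        ae_all_iff.2 fun g : K => a.act_mul g (i₂ (θ c))] with x hx1 hx2
      refine propext (forall_congr' fun g => ?_)
      have heq : θ ((φ g).2 • c) = (φ g).2 * θ c := by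
        by_contra hne
        exact hc ⟨_, Finset.mem_image_of_mem _ g.2, hne⟩
      have hgroup : i₂ (θ ((φ g).2 • c)) * i₁ g = g * i₂ (θ c) := by
        rw [heq]
        apply φ.injective
        simp [i₁, i₂, Prod.ext_iff]
      have h1 := hx1 g
      have h2 := hx2 g
      rw [hgroup, h2] at h1
      simp only [Function.comp_apply] at h1
      rw [← h1]
    have hm : MeasurableSet {x | ∀ g : K, P (a.act g x) = w g} := by
      rw [ofPred_forall]
      exact .iInter fun g => (hP.comp (a.measurePreserving_act g).measurable)
        (measurableSet_singleton (w g))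
    rw [measureReal_congr hsec, Measure.real,
      (a.measurePreserving_act _).measure_preimage hm.nullMeasurableSet, Measure.real]

end Product

theorem mainTheorem5 {Γ : Type u} [Group Γ] [Countable Γ] [Infinite Γ]
    (hΓ : HasMD Γ ∨
      ∃ (G H : Type u) (_ : Group G) (_ : Group H), Infinite H ∧ IsAmenableGroup H ∧
        Group.ResiduallyFinite H ∧ Nonempty (Γ ≃* G × H))
    {X : Type v} [MeasurableSpace X] [StandardBorelSpace X]
    (μ : Measure X) [IsProbabilityMeasure μ] [NullSingletonClass μ] :
    ∃ S : Set (ActionSpace Γ μ),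
      IsGδ S ∧ Dense S ∧ S ⊆ {a : ActionSpace Γ μ | naiveEntropy a = 0} := by
  refine ⟨{a | a.IsRigid}, ActionSpace.isGδ_setOf_isRigid, ?_, fun a ha => ha.naiveEntropy_eq_zero⟩
  rcases hΓ with (hΓ | hΓ) | ⟨G, H, _, _, _, hA, _, ⟨φ⟩⟩
  · exact hΓ.dense_isRigid μ
  · exact hΓ.dense_isRigid μ
  · exact dense_isRigid_of_mulEquiv_prod hA φ μ
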